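/- Let $A=(A_{ij})_{i,j\in\{0,\dots,N-1\}}$ be a matrix with entries in $\{0,1\}$ such that $A_{ii}=1$ for all $i$ and such that some power $A^n$ has only positive entries. Let $$\Lambda_A=\{(x_n)_{n\ge 0}\,:\,x_n\in\{0,\dots,N-1\},\ A_{x_n x_{n+1}}=1\ \text{for all } n\},$$ realized in $[0,1]$ by $x\mapsto \sum_n x_nN^{-n-1}$. Let $\delta_A$ be the Hausdorff dimension of this realization, and let $\mu=\mu_A$ be the Hausdorff measure in dimension $\delta_A$, i.e. $\mu(E)$ is the $\delta_A$-dimensional Hausdorff measure of the realization of $E\subset\Lambda_A$. A finite word $a=(a_1,\dots,a_k)$ is admissible if $A_{a_ia_{i+1}}=1$ for $1\le i<k$; $\mathcal W_{k,A}$ is the set of admissible words of length $k$ (for $k=0$ only the empty word), and $\Lambda_{k,A}(a)$ is the set of $w\in\Lambda_A$ that begin with $a$. Write $R_i=\Lambda_{1,A}(i)$ and $R_{ij}=\Lambda_{2,A}(ij)$. Let $\sigma$ be the one-sided shift on $\Lambda_A$, $D_i=\{w\in\Lambda_A: A_{iw_0}=1\}$, $\sigma_i:D_i\to R_i$, $\sigma_i(w)=iw$,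 and $\Phi_{\sigma_i}=\frac{d(\mu\circ\sigma_i)}{d\mu}$. Let $S_i$ be the operators $(S_i\psi)(x)=\chi_{R_i}(x)\,\Phi_{\sigma_i}(\sigma(x))^{-1/2}\,\psi(\sigma(x))$ on $L^2(\Lambda_A,\mu)$, and put $S_a=S_{a_1}\cdots S_{a_k}$ (the identity for the empty word). Let $\mathfrak S_k\subset L^2(\Lambda_A,\mu)$ be the space of functions that are $\mu$-almost everywhere constant on each $\Lambda_{k,A}(a)$, $a\in\mathcal W_{k,A}$. Put $d_r=\#\{j: A_{rj}=1\}$. Theorem. For $r=0,\dots,N-1$ and $\ell=1,\dots,d_r-1$ let $$f^{\ell,r}=\sum_j A_{rj}\,c^{\ell,r}_j\,\chi_{R_{rj}},\qquad c_j^{\ell,r}\in\mathbb C,$$ be such that for every $r$ and all $\ell,\ell'$ $$\int_{R_r}\overline{f^{\ell,r}}\,f^{\ell',r}\,d\mu=\delta_{\ell,\ell'},\qquad \int_{R_r}f^{\ell,r}\,d\mu=0 .$$ Consider the functions $\psi^{\ell,r}_a=S_af^{\ell,r}$ for $k\ge 0$, $a\in\mathcal W_{k,A}$ and $r$ such that $ar$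 is admissible (that is, $A_{a_kr}=1$ if $k\ge 1$). 1. They belong to $L^2(\Lambda_A,\mu)$, and for each $k\ge 0$ those with $a\in\mathcal W_{k,A}$ form an orthonormal basis of $\mathfrak S_{k+2}\ominus\mathfrak S_{k+1}$. In particular (for $k=0$) the $f^{\ell,r}$ form an orthonormal basis of $\mathfrak S_2\ominus\mathfrak S_1$. For $a$ admissible and $ar$ not admissible, $S_af^{\ell,r}=0$. 2. Taken over all $k\ge 0$, the functions $\psi_a^{\ell,r}$ form an orthonormal basis of the orthogonal complement of $\mathfrak S_1$ in $L^2(\Lambda_A,\mu)$. Together with the $N$ functions $\mu(R_i)^{-1/2}\chi_{R_i}$ of $\mathfrak S_1$ they form an orthonormal basis of $L^2(\Lambda_A,\mu)$. -/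

import Mathlib

open MeasureTheory Set
open scoped ENNReal ComplexConjugate

namespace CKWavelet

/-- `Λ_A`: the infinite words `x₀x₁x₂…` in the alphabet `{0, …, N-1}` that are admissible for the
matrix `A`, with the product `σ`-algebra (which is the Borel one). -/
abbrev Shift {N : ℕ} (A : Matrix (Fin N) (Fin N) ℕ) : Type :=
  {x : ℕ → Fin N // ∀ n, A (x n) (x (n + 1)) = 1}

/-- The point `0.x₀x₁x₂…` of `[0,1]` (in base `N`) that realizes a word of `Λ_A`. -/
noncomputable def value {N : ℕ} (A : Matrix (Fin N) (Fin N) ℕ) (w : Shift A) : ℝ :=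
  Real.ofDigits w.1

/-- `δ_A`: the Hausdorff dimension of `Λ_A`, realized as a subset of `[0,1]`. -/
noncomputable def hdim {N : ℕ} (A : Matrix (Fin N) (Fin N) ℕ) : ℝ :=
  (dimH (range (value A))).toReal

/-- The `δ_A`-dimensional Hausdorff (outer) measure, read on words:
`E ↦ H^{δ_A}({0.x₀x₁x₂… | x ∈ E})`. -/
noncomputable def hausdorffOuter {N : ℕ} (A : Matrix (Fin N) (Fin N) ℕ) :
    OuterMeasure (Shift A) :=
  OuterMeasure.comap (value A) (Measure.hausdorffMeasure (X := ℝ) (hdim A)).toOuterMeasure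

open Classical in
/-- `μ_A`: the Hausdorff measure of `Λ_A` in dimension `δ_A`, i.e. `E ↦ H^{δ_A}(value(E))` on
measurable sets of words. As in `Measure.comap`, the default value `0` is used when this is not
a measure; this does not occur if `δ_A > 0` (`hausdorffOuter_caratheodory`, `mu_apply`), nor if
`value` is injective. -/
noncomputable def mu {N : ℕ} (A : Matrix (Fin N) (Fin N) ℕ) : Measure (Shift A) :=
  if h : (inferInstance : MeasurableSpace (Shift A)) ≤ (hausdorffOuter A).caratheodory then
    (hausdorffOuter A).toMeasure h
  else 0

/-- Two words with the same value have a rational value. -/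
lemma value_mem_rat_of_lt {N : ℕ} (x y : ℕ → Fin N) (n : ℕ) (hlt : x n < y n)
    (hn : ∀ i < n, x i = y i) (h : Real.ofDigits x = Real.ofDigits y) :
    Real.ofDigits y ∈ range ((↑) : ℚ → ℝ) := by
  have hN : 0 < N := Fin.pos (x 0)
  have hN' : (0 : ℝ) < N := by exact_mod_cast hN
  have hx := Real.ofDigits_eq_sum_add_ofDigits x (n + 1)
  have hy := Real.ofDigits_eq_sum_add_ofDigits y (n + 1)
  rw [Finset.sum_range_succ] at hx hy
  have hs : ∑ i ∈ Finset.range n, Real.ofDigitsTerm x i =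
      ∑ i ∈ Finset.range n, Real.ofDigitsTerm y i :=
    Finset.sum_congr rfl fun i hi => by simp [Real.ofDigitsTerm, hn i (Finset.mem_range.mp hi)]
  set p : ℝ := ((N : ℝ) ^ (n + 1))⁻¹ with hp
  have hp0 : 0 < p := by positivity
  have htx : Real.ofDigitsTerm x n = (x n : ℕ) * p := rfl
  have hty : Real.ofDigitsTerm y n = (y n : ℕ) * p := rfl
  have hd : ((x n : ℕ) : ℝ) + 1 ≤ ((y n : ℕ) : ℝ) := by exact_mod_cast hlt
  set u := Real.ofDigits (fun i => x (i + (n + 1)))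
  set v := Real.ofDigits (fun i => y (i + (n + 1)))
  have hu : u ≤ 1 := Real.ofDigits_le_one _
  have hv : 0 ≤ v := Real.ofDigits_nonneg _
  have e : ((x n : ℕ) : ℝ) * p + p * u = ((y n : ℕ) : ℝ) * p + p * v := by
    rw [← htx, ← hty]; linarith
  have e' : ((x n : ℕ) : ℝ) + u = ((y n : ℕ) : ℝ) + v := by
    have : p * (((x n : ℕ) : ℝ) + u) = p * (((y n : ℕ) : ℝ) + v) := by linarith
    exact mul_left_cancel₀ hp0.ne' this
  have hv0 : v = 0 := by linarith
  refine ⟨∑ i ∈ Finset.range (n + 1), ((y i : ℕ) : ℚ) * ((N : ℚ) ^ (i + 1))⁻¹, ?_⟩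
  rw [hy, hv0, mul_zero, add_zero, ← Finset.sum_range_succ]
  push_cast
  rfl

lemma value_mem_rat {N : ℕ} (A : Matrix (Fin N) (Fin N) ℕ) {x y : Shift A} (hne : x ≠ y)
    (h : value A x = value A y) : value A y ∈ range ((↑) : ℚ → ℝ) := by
  classical
  have hex : ∃ n, x.1 n ≠ y.1 n := by
    by_contra hc
    push Not at hc
    exact hne (Subtype.ext (funext hc))
  have hn : ∀ i < Nat.find hex, x.1 i = y.1 i := fun i hi => by
    simpa using Nat.find_min hex hi
  rcases lt_or_gt_of_ne (Nat.find_spec hex) with hlt | hlt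
  · exact value_mem_rat_of_lt _ _ _ hlt hn h
  · have := value_mem_rat_of_lt _ _ _ hlt (fun i hi => (hn i hi).symm) h.symm
    rw [← h]
    exact this

/-- In positive dimension, `E ↦ H^{δ_A}(value(E))` is a measure. -/
theorem hausdorffOuter_caratheodory {N : ℕ} (A : Matrix (Fin N) (Fin N) ℕ) (hA : 0 < hdim A) :
    (inferInstance : MeasurableSpace (Shift A)) ≤ (hausdorffOuter A).caratheodory := by
  intro E hE
  set H : Measure ℝ := Measure.hausdorffMeasure (X := ℝ) (hdim A) with hH
  have : NullSingletonClass H := Measure.nullSingletonClass_hausdorff ℝ hA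
  set Q : Set ℝ := range ((↑) : ℚ → ℝ) with hQ
  have hQc : Q.Countable := countable_range _
  have hQ0 : H Q = 0 := hQc.measure_zero H
  have hcont : Continuous (value A) := Real.continuous_ofDigits.comp continuous_subtype_val
  have hclosed : IsClosed {x : ℕ → Fin N | ∀ n, A (x n) (x (n + 1)) = 1} := by
    rw [ofPred_forall]
    refine isClosed_iInter fun n => ?_
    have hc : Continuous fun x : ℕ → Fin N => (x n, x (n + 1)) := by fun_prop
    exact (isClosed_discrete {p : Fin N × Fin N | A p.1 p.2 = 1}).preimage hc
  have : PolishSpace (Fin N) := inferInstance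
  have : PolishSpace (ℕ → Fin N) := inferInstance
  have : PolishSpace (Shift A) := hclosed.polishSpace
  have hinj : InjOn (value A) (E \ value A ⁻¹' Q) := by
    intro x _ y hy hxy
    by_contra hne
    exact hy.2 (value_mem_rat A hne hxy)
  have hm : MeasurableSet (value A '' (E \ value A ⁻¹' Q)) :=
    (hE.diff (hcont.measurable hQc.measurableSet)).image_of_continuousOn_injOn
      hcont.continuousOn hinj
  have hnull : NullMeasurableSet (value A '' E) H := by
    have : value A '' E = value A '' (E \ value A ⁻¹' Q) ∪ value A '' (E ∩ value A ⁻¹' Q) := by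
      rw [← image_union, sdiff_union_inter]
    rw [this]
    refine hm.nullMeasurableSet.union (NullMeasurableSet.of_null (measure_mono_null ?_ hQ0))
    rintro _ ⟨x, hx, rfl⟩
    exact hx.2
  refine (OuterMeasure.isCaratheodory_iff_le _).2 fun S => ?_
  change H (value A '' (S ∩ E)) + H (value A '' (S \ E)) ≤ H (value A '' S)
  rw [← measure_inter_add_sdiff₀ (value A '' S) hnull]
  refine add_le_add (measure_mono (image_inter_subset _ _ _)) ?_
  · have hsub : value A '' (S \ E) ⊆ (value A '' S \ value A '' E) ∪ Q := by
      rintro _ ⟨x, hx, rfl⟩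
      by_cases hxQ : value A x ∈ Q
      · exact Or.inr hxQ
      · refine Or.inl ⟨mem_image_of_mem _ hx.1, ?_⟩
        rintro ⟨y, hy, hyx⟩
        exact hxQ (value_mem_rat A (fun hh : y = x => hx.2 (hh ▸ hy)) hyx)
    calc H (value A '' (S \ E)) ≤ H ((value A '' S \ value A '' E) ∪ Q) := measure_mono hsub
      _ ≤ H (value A '' S \ value A '' E) + H Q := measure_union_le _ _
      _ = H (value A '' S \ value A '' E) := by rw [hQ0, add_zero]

theorem mu_apply {N : ℕ} (A : Matrix (Fin N) (Fin N) ℕ) (hA : 0 < hdim A) {E : Set (Shift A)}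
    (hE : MeasurableSet E) :
    mu A E = Measure.hausdorffMeasure (X := ℝ) (hdim A) (value A '' E) := by
  rw [mu, dif_pos (hausdorffOuter_caratheodory A hA), toMeasure_apply _ _ hE]
  rfl

/-- A finite word is admissible if `A_{a_i a_{i+1}} = 1` for all consecutive letters. -/
def Admissible {N : ℕ} (A : Matrix (Fin N) (Fin N) ℕ) (a : List (Fin N)) : Prop :=
  a.IsChain (fun i j => A i j = 1)

/-- `Λ_{k,A}(a)` with `k = a.length`: the words of `Λ_A` that start with `a`. In particular
`R_i = cylinder A [i]` and `R_{ij} = cylinder A [i, j]`. -/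
def cylinder {N : ℕ} (A : Matrix (Fin N) (Fin N) ℕ) (a : List (Fin N)) : Set (Shift A) :=
  {w | ∀ (n : ℕ) (h : n < a.length), w.1 n = a[n]}

/-- The one-sided shift `σ(x₀x₁x₂…) = x₁x₂…`. -/
def shift {N : ℕ} (A : Matrix (Fin N) (Fin N) ℕ) (w : Shift A) : Shift A :=
  ⟨fun n => w.1 (n + 1), fun n => w.2 (n + 1)⟩

/-- `D_i`: the words to which the letter `i` may be prefixed. -/
def dom {N : ℕ} (A : Matrix (Fin N) (Fin N) ℕ) (i : Fin N) : Set (Shift A) :=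
  {w | A i (w.1 0) = 1}

/-- `σ_i : D_i → R_i`, `σ_i(w) = iw`. -/
def branch {N : ℕ} (A : Matrix (Fin N) (Fin N) ℕ) (i : Fin N) (w : dom A i) : Shift A :=
  ⟨fun n => Nat.casesOn n i (fun m => w.1.1 m), fun n => by
    cases n with
    | zero => exact w.2
    | succ m => exact w.1.2 m⟩

/-- The measure `μ_A ∘ σ_i : E ↦ μ_A(σ_i(E ∩ D_i))`. -/
noncomputable def muBranch {N : ℕ} (A : Matrix (Fin N) (Fin N) ℕ) (i : Fin N) :
    Measure (Shift A) :=
  ((mu A).comap (branch A i)).map Subtype.val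

/-- The Radon–Nikodym derivative `Φ_{σ_i} = d(μ_A ∘ σ_i)/dμ_A`. -/
noncomputable def Phi {N : ℕ} (A : Matrix (Fin N) (Fin N) ℕ) (i : Fin N) (w : Shift A) : ℝ :=
  ((muBranch A i).rnDeriv (mu A) w).toReal

/-- The generator `S_i` of the representation of the Cuntz–Krieger algebra:
`(S_i ψ)(x) = χ_{R_i}(x) Φ_{σ_i}(σ(x))^{-1/2} ψ(σ(x))`. -/
noncomputable def S {N : ℕ} (A : Matrix (Fin N) (Fin N) ℕ) (i : Fin N) (ψ : Shift A → ℂ) :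
    Shift A → ℂ :=
  (cylinder A [i]).indicator
    fun w => ((Phi A i (shift A w) ^ (-(1 / 2) : ℝ) : ℝ) : ℂ) * ψ (shift A w)

/-- `S_a = S_{a_1} ⋯ S_{a_k}`, the identity for the empty word. -/
noncomputable def SWord {N : ℕ} (A : Matrix (Fin N) (Fin N) ℕ) (a : List (Fin N))
    (ψ : Shift A → ℂ) : Shift A → ℂ :=
  a.foldr (S A) ψ

/-- `𝔖_k ⊆ L²(Λ_A, μ_A)`: the functions that agree `μ_A`-almost everywhere with a constant on each
cylinder `Λ_{k,A}(a)`, `a` an admissible word of length `k`. -/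
noncomputable def levelSpace {N : ℕ} (A : Matrix (Fin N) (Fin N) ℕ) (k : ℕ) :
    Submodule ℂ (Lp ℂ 2 (mu A)) where
  carrier := {f | ∀ a : List (Fin N), a.length = k → Admissible A a →
    ∃ z : ℂ, ∀ᵐ w ∂(mu A), w ∈ cylinder A a → f w = z}
  add_mem' := by
    intro f g hf hg a ha ha'
    obtain ⟨z, hz⟩ := hf a ha ha'
    obtain ⟨z', hz'⟩ := hg a ha ha'
    refine ⟨z + z', ?_⟩
    filter_upwards [hz, hz', Lp.coeFn_add f g] with w h1 h2 h3 hw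
    rw [h3, Pi.add_apply, h1 hw, h2 hw]
  zero_mem' := by
    intro a _ _
    refine ⟨0, ?_⟩
    filter_upwards [Lp.coeFn_zero ℂ 2 (mu A)] with w h _
    rw [h, Pi.zero_apply]
  smul_mem' := by
    intro t f hf a ha ha'
    obtain ⟨z, hz⟩ := hf a ha ha'
    refine ⟨t * z, ?_⟩
    filter_upwards [hz, Lp.coeFn_smul t f] with w h1 h2 hw
    rw [h2, Pi.smul_apply, h1 hw, smul_eq_mul]

/-- The orthogonal difference `𝔖_m ⊖ 𝔖_k` (for `k ≤ m`). -/
noncomputable def levelDiff {N : ℕ} (A : Matrix (Fin N) (Fin N) ℕ) (m k : ℕ) :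
    Submodule ℂ (Lp ℂ 2 (mu A)) :=
  levelSpace A m ⊓ (levelSpace A k)ᗮ

/-- `d_r = #{j | A_{rj} = 1}`. -/
def outDegree {N : ℕ} (A : Matrix (Fin N) (Fin N) ℕ) (r : Fin N) : ℕ :=
  (Finset.univ.filter fun j => A r j = 1).card

/-- `f^{ℓ,r} = ∑_j A_{rj} c^{ℓ,r}_j χ_{R_{rj}}`, for `r = 0, …, N-1` and `ℓ = 1, …, d_r - 1`. -/
noncomputable def mother {N : ℕ} (A : Matrix (Fin N) (Fin N) ℕ)
    (c : (r : Fin N) → Fin (outDegree A r - 1) → Fin N → ℂ) (r : Fin N)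
    (l : Fin (outDegree A r - 1)) (w : Shift A) : ℂ :=
  ∑ j, (A r j : ℂ) * c r l j * (cylinder A [r, j]).indicator (fun _ => (1 : ℂ)) w

/-- The two conditions on the `f^{ℓ,r}`: for each `r` they are orthonormal on `R_r` and have
vanishing integral. -/
structure IsMotherFamily {N : ℕ} (A : Matrix (Fin N) (Fin N) ℕ)
    (c : (r : Fin N) → Fin (outDegree A r - 1) → Fin N → ℂ) : Prop where
  orthonormal : ∀ (r : Fin N) (l l' : Fin (outDegree A r - 1)),
    ∫ w in cylinder A [r], conj (mother A c r l w) * mother A c r l' w ∂(mu A) =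
      if l = l' then 1 else 0
  mean_zero : ∀ (r : Fin N) (l : Fin (outDegree A r - 1)),
    ∫ w in cylinder A [r], mother A c r l w ∂(mu A) = 0

/-- Indices `(a, r, ℓ)` of the wavelets at scale `k`: `a` is a word of length `k` and `r` a letter
such that `ar` is admissible (i.e. `a` is admissible and, if `k ≥ 1`, `A_{a_k r} = 1`), and
`ℓ = 1, …, d_r - 1`. -/
abbrev WaveletIndex {N : ℕ} (A : Matrix (Fin N) (Fin N) ℕ) (k : ℕ) : Type :=
  Σ p : {p : List (Fin N) × Fin N // p.1.length = k ∧ Admissible A (p.1 ++ [p.2])},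
    Fin (outDegree A p.1.2 - 1)

/-- The wavelet `ψ_a^{ℓ,r} = S_a f^{ℓ,r}`. -/
noncomputable def wavelet {N : ℕ} (A : Matrix (Fin N) (Fin N) ℕ)
    (c : (r : Fin N) → Fin (outDegree A r - 1) → Fin N → ℂ) (k : ℕ) (i : WaveletIndex A k) :
    Shift A → ℂ :=
  SWord A i.1.1.1 (mother A c i.1.1.2 i.2)

/-- The normalized characteristic function `μ_A(R_i)^{-1/2} χ_{R_i}`. -/
noncomputable def scaling {N : ℕ} (A : Matrix (Fin N) (Fin N) ℕ) (i : Fin N) : Shift A → ℂ :=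
  (cylinder A [i]).indicator
    fun _ => (((mu A (cylinder A [i])).toReal ^ (-(1 / 2) : ℝ) : ℝ) : ℂ)

/-- The family `v` is an orthonormal (Hilbert) basis of the closed subspace `V`: it is orthonormal
and its closed linear span is `V`. -/
def IsOrthonormalBasisOf {ι E : Type*} [NormedAddCommGroup E] [InnerProductSpace ℂ E] (v : ι → E)
    (V : Submodule ℂ E) : Prop :=
  Orthonormal ℂ v ∧ (Submodule.span ℂ (range v)).topologicalClosure = V

end CKWavelet

/-! Everything rests on one property of `mu A`: it is finite, positive on each `R_i`, and every
branch `σ_i` multiplies it by the same constant `q = N ^ (-δ_A)` (`IsSelfSimilar`). On values, `σ_i`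
is the similarity `y ↦ (y + i) / N`, so the scaling is that of Hausdorff measure. Finiteness and
positivity come from counting words: the number `W(n)` of words of length `n` is submultiplicative,
and supermultiplicative up to a constant because some power of `A` is positive. Hence `W(n)` lies
between `exp (n * L)` and `C * exp (n * L)` (`exists_growth_rate`). Covering by cylinders bounds the
measure in dimension `L / log N` from above. Comparing an arbitrary cover with words of one common
length bounds it from below (`one_le_tsum_of_cover`), so this dimension is `δ_A`.

Granted this, `Φ_{σ_i}` equals `q` almost everywhere on `D_i`. For `a` of length `k`, `S_a f^{ℓ,r}`
is therefore `q ^ (-k/2)` times the combination of the `χ_{arj}` with the coefficients of `f^{ℓ,r}`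
(`SWord_mother_ae_eq`). As `μ(Λ(arj)) = q ^ k * μ(R_{rj})`, inner products reduce to those at `k =
0`: orthonormality carries over, and mean zero becomes orthogonality to `χ_{ar}`, hence to
`𝔖_{k+1}`. The `d_r - 1` wavelets at `ar` and `χ_{ar}` are `d_r` independent vectors in the span of
the `d_r` functions `χ_{arj}`, so they span it (`chi_mem_span_sup`). Cylinders generate the
`σ`-algebra, so the union of the `𝔖_k` is dense, which gives the bases of `𝔖_1ᗮ` and of `L²`. -/

namespace CKWavelet

/-! ### Growth of the number of words. -/

/-- The first `n` letters of a word of `Λ_A`. -/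
def initialWord {N : ℕ} (A : Matrix (Fin N) (Fin N) ℕ) (n : ℕ) (w : Shift A) : Fin n → Fin N :=
  fun i => w.1 i

/-- The number of words of length `n` that occur as initial words in `Λ_A`. -/
noncomputable def wordCount {N : ℕ} (A : Matrix (Fin N) (Fin N) ℕ) (n : ℕ) : ℕ :=
  (range (initialWord A n)).ncard

/-- The `n`-fold iterate of the shift. -/
def shiftIter {N : ℕ} (A : Matrix (Fin N) (Fin N) ℕ) (n : ℕ) (w : Shift A) : Shift A :=
  ⟨fun k => w.1 (k + n), fun k => by
    have := w.2 (k + n)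
    rwa [Nat.add_right_comm] at this⟩

variable {N : ℕ} {A : Matrix (Fin N) (Fin N) ℕ}

lemma initialWord_eq_iff {n : ℕ} {w w' : Shift A} :
    initialWord A n w = initialWord A n w' ↔ ∀ i < n, w.1 i = w'.1 i :=
  ⟨fun h i hi => congrFun h ⟨i, hi⟩, fun h => funext fun i => h i i.2⟩

lemma wordCount_pos [Nonempty (Shift A)] (n : ℕ) : 0 < wordCount A n :=
  (ncard_pos (toFinite _)).2 (range_nonempty _)

lemma wordCount_zero_le : wordCount A 0 ≤ 1 := by
  refine (ncard_le_one (toFinite _)).2 fun a _ b _ => Subsingleton.elim _ _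

/-- A set of words with `K` initial words of length `m` has at most `K * wordCount A n` initial
words of length `m + n`. -/
lemma ncard_image_initialWord_add_le (V : Set (Shift A)) (m n : ℕ) :
    (initialWord A (m + n) '' V).ncard ≤ (initialWord A m '' V).ncard * wordCount A n := by
  rw [wordCount, ← ncard_prod]
  refine ncard_le_ncard_of_injOn
    (fun g => (fun i => g (Fin.castAdd n i), fun i => g (Fin.natAdd m i))) ?_ ?_ (toFinite _)
  · rintro _ ⟨w, hw, rfl⟩
    refine ⟨⟨w, hw, rfl⟩, ⟨shiftIter A m w, ?_⟩⟩
    funext i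
    simp [initialWord, shiftIter, add_comm]
  · intro g _ g' _ h
    rw [Prod.mk.injEq] at h
    funext i
    refine Fin.addCases (fun i => congrFun h.1 i) (fun i => congrFun h.2 i) i

lemma wordCount_add_le (m n : ℕ) : wordCount A (m + n) ≤ wordCount A m * wordCount A n := by
  have := ncard_image_initialWord_add_le (A := A) univ m n
  rwa [image_univ, image_univ] at this

lemma ncard_le_of_surjOn {α β : Type*} {s : Set α} {t : Set β} (f : α → β) (h : SurjOn f s t)
    (hs : s.Finite) : t.ncard ≤ s.ncard :=
  (ncard_le_ncard h (hs.image f)).trans (ncard_image_le hs)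

/-- A positive entry of `A ^ q` gives a path of length `q`. -/
lemma exists_path_of_pow_pos (h01 : ∀ i j, A i j = 0 ∨ A i j = 1) (q : ℕ) :
    ∀ i j, 0 < (A ^ q) i j →
      ∃ u : ℕ → Fin N, u 0 = i ∧ u q = j ∧ ∀ n < q, A (u n) (u (n + 1)) = 1 := by
  induction q with
  | zero =>
    intro i j h
    have hij : i = j := by
      by_contra hne
      simp [Matrix.one_apply_ne hne] at h
    exact ⟨fun _ => i, rfl, hij, fun n hn => absurd hn (Nat.not_lt_zero n)⟩
  | succ q ih =>
    intro i j h
    rw [pow_succ', Matrix.mul_apply] at h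
    obtain ⟨k, -, hk⟩ := Finset.exists_ne_zero_of_sum_ne_zero h.ne'
    have h1 : A i k = 1 := (h01 i k).resolve_left (left_ne_zero_of_mul hk)
    obtain ⟨u, hu0, huq, hu⟩ := ih k j (Nat.pos_of_ne_zero (right_ne_zero_of_mul hk))
    refine ⟨fun n => Nat.casesOn n i u, rfl, huq, ?_⟩
    rintro (_ | n) hn
    · change A i (u 0) = 1
      rw [hu0, h1]
    · exact hu n (by omega)

/-- Any two words may be joined by a path of length `q`. -/
lemma exists_glue (h01 : ∀ i j, A i j = 0 ∨ A i j = 1) {q : ℕ} (hq : ∀ i j, 0 < (A ^ q) i j)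
    (m : ℕ) (w w' : Shift A) :
    ∃ z : Shift A, (∀ t ≤ m, z.1 t = w.1 t) ∧ ∀ k, z.1 (m + q + k) = w'.1 k := by
  obtain ⟨u, hu0, huq, hu⟩ := exists_path_of_pow_pos h01 q (w.1 m) (w'.1 0) (hq _ _)
  -- The glued word follows `w` up to index `m`, then the path `u`, then `w'`. Neighbouring pieces
  -- agree at the indices `m` and `m + q`, so every transition lies inside one piece.
  have key : ∀ t, A (if t ≤ m then w.1 t else if t ≤ m + q then u (t - m) else w'.1 (t - m - q))
      (if t + 1 ≤ m then w.1 (t + 1) else if t + 1 ≤ m + q then u (t + 1 - m)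
        else w'.1 (t + 1 - m - q)) = 1 := by
    intro t
    by_cases h1 : t + 1 ≤ m
    · rw [if_pos (by omega), if_pos h1]
      exact w.2 t
    · rw [if_neg h1]
      have e1 : (if t ≤ m then w.1 t else if t ≤ m + q then u (t - m) else w'.1 (t - m - q)) =
          if t ≤ m + q then u (t - m) else w'.1 (t - m - q) := by
        by_cases h2 : t ≤ m
        · have : t = m := by omega
          subst this
          simp [hu0]
        · rw [if_neg h2]
      rw [e1]
      by_cases h3 : t + 1 ≤ m + q
      · rw [if_pos (by omega), if_pos h3, show t + 1 - m = t - m + 1 by omega]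
        exact hu _ (by omega)
      · rw [if_neg h3]
        have e2 : (if t ≤ m + q then u (t - m) else w'.1 (t - m - q)) = w'.1 (t - m - q) := by
          by_cases h4 : t ≤ m + q
          · have h5 : t - m = q := by omega
            rw [if_pos h4, h5, huq, Nat.sub_self]
          · rw [if_neg h4]
        rw [e2, show t + 1 - m - q = t - m - q + 1 by omega]
        exact w'.2 _
  refine ⟨⟨_, key⟩, fun t ht => if_pos ht, fun k => ?_⟩
  change (if m + q + k ≤ m then w.1 (m + q + k) else if m + q + k ≤ m + q then u (m + q + k - m)
    else w'.1 (m + q + k - m - q)) = w'.1 k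
  rcases Nat.eq_zero_or_pos k with rfl | hk
  · by_cases h1 : q = 0
    · subst h1
      simp [← hu0, huq]
    · rw [if_neg (by omega), if_pos (by omega), show m + q + 0 - m = q by omega, huq]
  · rw [if_neg (by omega), if_neg (by omega)]
    rw [show m + q + k - m - q = k by omega]

/-- Two words can be joined by a path of length `q`, and both can be read off from the result. The
additional `q` letters cost a factor `wordCount A q`. Gluing needs a last letter, so `m = 0` is
separate. -/
lemma wordCount_mul_le [Nonempty (Shift A)] (h01 : ∀ i j, A i j = 0 ∨ A i j = 1) {q : ℕ}
    (hq : ∀ i j, 0 < (A ^ q) i j) (m n : ℕ) :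
    wordCount A m * wordCount A n ≤ wordCount A q * wordCount A (m + n) := by
  cases m with
  | zero =>
    rw [Nat.zero_add]
    exact Nat.mul_le_mul_right _ (wordCount_zero_le.trans (wordCount_pos q))
  | succ m =>
    -- Since `w'` starts at index `m + q`, length `m + q + n` would do unless `q + n = 0`; the
    -- further letter makes the length `q + (m + 1 + n)`.
    have h1 : wordCount A (m + 1) * wordCount A n ≤ wordCount A (m + q + n + 1) := by
      rw [wordCount, wordCount, ← ncard_prod]
      refine ncard_le_of_surjOn (fun g => (fun i => g ⟨i, by omega⟩,
        fun i => g ⟨m + q + i, by omega⟩)) ?_ (toFinite _)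
      rintro ⟨_, _⟩ ⟨⟨w, rfl⟩, ⟨w', rfl⟩⟩
      obtain ⟨z, hz, hz'⟩ := exists_glue h01 hq m w w'
      refine ⟨initialWord A _ z, ⟨z, rfl⟩, ?_⟩
      rw [Prod.mk.injEq]
      exact ⟨funext fun i => hz i (by omega), funext fun i => hz' i⟩
    calc _ ≤ wordCount A (m + q + n + 1) := h1
      _ = wordCount A (q + (m + 1 + n)) := by congr 1; omega
      _ ≤ _ := wordCount_add_le _ _

/-- The word counts grow exactly exponentially. -/
lemma exists_growth_rate [Nonempty (Shift A)] (h01 : ∀ i j, A i j = 0 ∨ A i j = 1)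
    (hirr : ∃ n : ℕ, ∀ i j, 0 < (A ^ n) i j) :
    ∃ L C : ℝ, 0 < C ∧ ∀ n : ℕ, Real.exp (n * L) ≤ wordCount A n ∧
      (wordCount A n : ℝ) ≤ C * Real.exp (n * L) := by
  obtain ⟨q, hq⟩ := hirr
  have hpos : ∀ n, (0 : ℝ) < wordCount A n := fun n => by exact_mod_cast wordCount_pos n
  have hone : ∀ n, (1 : ℝ) ≤ wordCount A n := fun n => by exact_mod_cast wordCount_pos n
  set C : ℝ := (wordCount A q : ℝ) with hC
  set u : ℕ → ℝ := fun n => Real.log (wordCount A n) with hu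
  have hsub : Subadditive u := fun m n => by
    rw [hu]
    dsimp only
    rw [← Real.log_mul (hpos m).ne' (hpos n).ne']
    exact Real.log_le_log (hpos _) (by exact_mod_cast wordCount_add_le m n)
  -- Subadditivity of `v` is the lower bound on `wordCount A (m + n)`. Fekete's lemma for `u` gives
  -- `u n ≥ n * L`, and for `v`, whose limit is `-L`, it gives `u n ≤ log C + n * L`.
  set v : ℕ → ℝ := fun n => Real.log C - u n with hv
  have hsub' : Subadditive v := fun m n => by
    have h : Real.log (wordCount A m * wordCount A n) ≤ Real.log (C * wordCount A (m + n)) :=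
      Real.log_le_log (mul_pos (hpos m) (hpos n)) (by
        rw [hC]
        exact_mod_cast wordCount_mul_le h01 hq m n)
    rw [Real.log_mul (hpos m).ne' (hpos n).ne', Real.log_mul (hpos q).ne' (hpos _).ne'] at h
    simp only [hv, hu]
    linarith
  have hu0 : ∀ n, 0 ≤ u n := fun n => Real.log_nonneg (hone n)
  have hu1 : ∀ n : ℕ, u n ≤ n * u 1 := by
    intro n
    induction n with
    | zero =>
      have : wordCount A 0 = 1 := le_antisymm wordCount_zero_le (wordCount_pos 0)
      simp [hu, this]
    | succ n ih =>
      have := hsub n 1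
      push_cast
      linarith
  have hC0 : 0 ≤ Real.log C := Real.log_nonneg (hone q)
  have hb : BddBelow (range fun n => u n / n) :=
    ⟨0, by rintro _ ⟨n, rfl⟩; exact div_nonneg (hu0 n) n.cast_nonneg⟩
  have hb' : BddBelow (range fun n => v n / n) := by
    refine ⟨-u 1, ?_⟩
    rintro _ ⟨n, rfl⟩
    rcases Nat.eq_zero_or_pos n with rfl | hn
    · simpa using hu0 1
    · have hn' : (0 : ℝ) < n := by exact_mod_cast hn
      dsimp only
      rw [le_div_iff₀ hn']
      have := hu1 n
      simp only [hv]
      linarith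
  have hlim : hsub'.lim = -hsub.lim := by
    refine tendsto_nhds_unique (hsub'.tendsto_lim hb') ?_
    have h1 : Filter.Tendsto (fun n : ℕ => Real.log C / n - u n / n) Filter.atTop
        (nhds (0 - hsub.lim)) :=
      (tendsto_const_div_atTop_nhds_zero_nat (Real.log C)).sub (hsub.tendsto_lim hb)
    rw [zero_sub] at h1
    refine h1.congr fun n => ?_
    simp only [hv, sub_div]
  refine ⟨hsub.lim, C, hpos q, fun n => ?_⟩
  rcases Nat.eq_zero_or_pos n with rfl | hn
  · have h0 : wordCount A 0 = 1 := le_antisymm wordCount_zero_le (wordCount_pos 0)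
    simp only [h0, Nat.cast_zero, zero_mul, Real.exp_zero, Nat.cast_one, le_refl, mul_one, true_and]
    exact hone q
  · have hn' : (0 : ℝ) < n := by exact_mod_cast hn
    have h1 := hsub.lim_le_div hb hn.ne'
    have h2 := hsub'.lim_le_div hb' hn.ne'
    rw [hlim] at h2
    rw [le_div_iff₀ hn'] at h1 h2
    constructor
    · rw [← Real.le_log_iff_exp_le (hpos n)]
      linarith
    · rw [← Real.log_le_log_iff (hpos n) (mul_pos (hpos q) (Real.exp_pos _)),
        Real.log_mul (hpos q).ne' (Real.exp_pos _).ne', Real.log_exp]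
      simp only [hv] at h2
      change u n ≤ _
      linarith

/-- With at least two letters, the number of words is unbounded. -/
lemma succ_le_wordCount (h01 : ∀ i j, A i j = 0 ∨ A i j = 1) (hdiag : ∀ i, A i i = 1)
    (hirr : ∃ n : ℕ, ∀ i j, 0 < (A ^ n) i j) (hN : 2 ≤ N) (n : ℕ) : n + 1 ≤ wordCount A n := by
  obtain ⟨i, j, hij, hA⟩ : ∃ i j, i ≠ j ∧ A i j = 1 := by
    by_contra! hc
    have hA1 : A = 1 := by
      ext i j
      rcases eq_or_ne i j with rfl | hne
      · rw [hdiag, Matrix.one_apply_eq]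
      · rw [Matrix.one_apply_ne hne]
        exact (h01 i j).resolve_right (hc i j hne)
    obtain ⟨q, hq⟩ := hirr
    have := hq ⟨0, by omega⟩ ⟨1, by omega⟩
    rw [hA1, one_pow, Matrix.one_apply_ne (by simp)] at this
    exact lt_irrefl _ this
  -- The loops at `i` and `j` make the words `i^k j j j …` admissible; for `k ≤ n` their first `n`
  -- letters are distinct.
  have hz : ∀ k t : ℕ, A (if t < k then i else j) (if t + 1 < k then i else j) = 1 := by
    intro k t
    by_cases h1 : t + 1 < k
    · rw [if_pos (by omega), if_pos h1, hdiag]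
    · rw [if_neg h1]
      split_ifs
      · exact hA
      · exact hdiag j
  let z : Fin (n + 1) → Shift A := fun k => ⟨_, hz k⟩
  have hinj : Function.Injective fun k => initialWord A n (z k) := by
    have hlt : ∀ k k' : Fin (n + 1), k < k' → initialWord A n (z k) ≠ initialWord A n (z k') := by
      intro k k' hlt h
      have h2 := initialWord_eq_iff.1 h k (by omega)
      change (if (k : ℕ) < k then i else j) = (if (k : ℕ) < k' then i else j) at h2
      rw [if_neg (lt_irrefl _), if_pos (Fin.lt_def.1 hlt)] at h2
      exact hij h2.symm
    intro k k' h
    by_contra hne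
    rcases lt_or_gt_of_ne hne with h1 | h1
    · exact hlt _ _ h1 h
    · exact hlt _ _ h1 h.symm
  calc n + 1 = (range fun k => initialWord A n (z k)).ncard := by
        rw [← image_univ, ncard_image_of_injective _ hinj, ncard_univ, Nat.card_fin]
    _ ≤ _ := ncard_le_ncard (by rintro _ ⟨k, rfl⟩; exact ⟨z k, rfl⟩) (toFinite _)

end CKWavelet

/-! ### Base `N` expansions and covers of `Λ_A`. -/

namespace CKWavelet

variable {N : ℕ} {A : Matrix (Fin N) (Fin N) ℕ}

lemma isClosed_admissible :
    IsClosed {x : ℕ → Fin N | ∀ n, A (x n) (x (n + 1)) = 1} := by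
  rw [ofPred_forall]
  refine isClosed_iInter fun n => ?_
  have hc : Continuous fun x : ℕ → Fin N => (x n, x (n + 1)) := by fun_prop
  exact (isClosed_discrete {p : Fin N × Fin N | A p.1 p.2 = 1}).preimage hc

instance : CompactSpace (Shift A) :=
  isCompact_iff_compactSpace.1 isClosed_admissible.isCompact

lemma continuous_initialWord (n : ℕ) : Continuous (initialWord A n) :=
  continuous_pi fun i => (continuous_apply (i : ℕ)).comp continuous_subtype_val

/-- The integer with base `N` digits the first `n` letters of a word. -/
noncomputable def wordNumber (n : ℕ) (g : Fin n → Fin N) : Fin (N ^ n) :=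
  -- `finFunctionFinEquiv` takes the least significant digit first, hence the reversal.
  finFunctionFinEquiv (g ∘ Fin.rev)

lemma wordNumber_injective (n : ℕ) :
    Function.Injective (wordNumber n : (Fin n → Fin N) → Fin (N ^ n)) := by
  intro g g' h
  have h1 := finFunctionFinEquiv.injective h
  funext i
  have := congrFun h1 i.rev
  simpa using this

/-- This splits `N ^ n * value` into an integer that determines the first `n` letters and a
remainder in `[0, 1]`; both comparisons between distance and initial words follow from it. -/
lemma pow_mul_value (w : Shift A) (n : ℕ) :
    (N : ℝ) ^ n * value A w = (wordNumber n (initialWord A n w) : ℕ) + value A (shiftIter A n w) := by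
  have hN : (N : ℝ) ≠ 0 := by exact_mod_cast (Fin.pos (w.1 0)).ne'
  have h := Real.ofDigits_eq_sum_add_ofDigits w.1 n
  change value A w = _ + _ * value A (shiftIter A n w) at h
  rw [h, mul_add, mul_inv_cancel_left₀ (pow_ne_zero n hN)]
  congr 1
  rw [wordNumber, finFunctionFinEquiv_apply, Finset.mul_sum, Finset.sum_range]
  push_cast
  rw [← Equiv.sum_comp Fin.revPerm]
  refine Finset.sum_congr rfl fun i _ => ?_
  simp only [Real.ofDigitsTerm, Fin.revPerm_apply, Function.comp_apply, initialWord]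
  rw [mul_left_comm]
  congr 1
  have h1 : (N : ℝ) ^ n = (N : ℝ) ^ (i : ℕ) * (N : ℝ) ^ ((i.rev : ℕ) + 1) := by
    rw [← pow_add]
    congr 1
    rw [Fin.val_rev]
    omega
  rw [h1, mul_inv_cancel_right₀ (pow_ne_zero _ hN)]

lemma value_nonneg (w : Shift A) : 0 ≤ value A w := Real.ofDigits_nonneg _

lemma value_le_one (w : Shift A) : value A w ≤ 1 := Real.ofDigits_le_one _

/-- Words with the same `n` initial letters have values at distance at most `N ^ (-n)`. -/
lemma abs_value_sub_le {n : ℕ} {w w' : Shift A} (h : initialWord A n w = initialWord A n w') :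
    |value A w - value A w'| ≤ ((N : ℝ) ^ n)⁻¹ := by
  have hN : (0 : ℝ) < N := by exact_mod_cast Fin.pos (w.1 0)
  have hp : (0 : ℝ) < (N : ℝ) ^ n := pow_pos hN n
  have h1 := pow_mul_value w n
  have h2 := pow_mul_value w' n
  rw [h] at h1
  have h3 : (N : ℝ) ^ n * (value A w - value A w') =
      value A (shiftIter A n w) - value A (shiftIter A n w') := by
    rw [mul_sub, h1, h2]
    ring
  have h4 : (N : ℝ) ^ n * |value A w - value A w'| ≤ 1 := by
    rw [← abs_of_pos hp, ← abs_mul, h3, abs_le]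
    constructor <;>
    linarith [value_nonneg (shiftIter A n w), value_nonneg (shiftIter A n w'),
      value_le_one (shiftIter A n w), value_le_one (shiftIter A n w')]
  rw [← one_div, le_div_iff₀ hp]
  linarith

/-- A set of words whose values are at distance at most `N ^ (-n)` has at most three initial words
of length `n`. -/
lemma ncard_initialWord_le_three {n : ℕ} {U : Set (Shift A)}
    (h : ∀ w ∈ U, ∀ w' ∈ U, |value A w - value A w'| ≤ ((N : ℝ) ^ n)⁻¹) :
    (initialWord A n '' U).ncard ≤ 3 := by
  rcases U.eq_empty_or_nonempty with rfl | hU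
  · simp
  let p : Shift A → ℕ := fun w => wordNumber n (initialWord A n w)
  have hpU : (p '' U).Nonempty := hU.image p
  obtain ⟨w0, hw0, hmin⟩ := WellFounded.has_min (r := (· < ·)) wellFounded_lt (p '' U) hpU
  obtain ⟨w0, hw0U, rfl⟩ := hw0
  have hN : (0 : ℝ) < N := by exact_mod_cast Fin.pos (w0.1 0)
  have hp : (0 : ℝ) < (N : ℝ) ^ n := pow_pos hN n
  -- The scaled values differ by at most `1` and the remainders lie in `[0, 1]`, so the integer
  -- parts exceed the least one by at most `2`.
  have hmap : ∀ w ∈ U, p w ∈ Finset.Icc (p w0) (p w0 + 2) := by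
    intro w hw
    rw [Finset.mem_Icc]
    refine ⟨not_lt.1 (hmin _ ⟨w, hw, rfl⟩), ?_⟩
    have h1 := pow_mul_value w n
    have h2 := pow_mul_value w0 n
    have h3 := (abs_le.1 (h w hw w0 hw0U)).2
    have h4 : (N : ℝ) ^ n * (value A w - value A w0) ≤ 1 := by
      have := mul_le_mul_of_nonneg_left h3 hp.le
      rwa [mul_inv_cancel₀ hp.ne'] at this
    have h5 : ((p w : ℕ) : ℝ) ≤ ((p w0 + 2 : ℕ) : ℝ) := by
      push_cast
      change _ = (p w : ℝ) + _ at h1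
      change _ = (p w0 : ℝ) + _ at h2
      have := value_nonneg (shiftIter A n w)
      have := value_le_one (shiftIter A n w0)
      linarith
    exact_mod_cast h5
  calc (initialWord A n '' U).ncard ≤ (Finset.Icc (p w0) (p w0 + 2) : Set ℕ).ncard := by
        refine ncard_le_ncard_of_injOn (fun g => (wordNumber n g : ℕ)) ?_ ?_ (Finset.finite_toSet _)
        · rintro _ ⟨w, hw, rfl⟩
          exact hmap w hw
        · intro g _ g' _ hg
          exact wordNumber_injective n (Fin.ext hg)
    _ = 3 := by
        rw [ncard_coe_finset, Nat.card_Icc]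
        omega

/-- If `Λ_A` is covered by sets `t i`, and `t i` has at most three initial words of length `n i`,
then the masses `exp (-n i * L)` of these words have a total bounded from below. -/
lemma one_le_tsum_of_cover {L C : ℝ}
    (hL : ∀ n : ℕ, Real.exp (n * L) ≤ wordCount A n ∧ (wordCount A n : ℝ) ≤ C * Real.exp (n * L))
    (t : ℕ → Set (Shift A)) (ht : ⋃ i, t i = univ) (n : ℕ → ℕ)
    (hn : ∀ i, (initialWord A (n i) '' t i).ncard ≤ 3) :
    1 ≤ ∑' i, ENNReal.ofReal (3 * C * Real.exp (-(n i * L))) := by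
  have hC : 0 ≤ C := by
    have h := hL 0
    have h1 : (0 : ℝ) < C * Real.exp ((0 : ℕ) * L) := (Real.exp_pos _).trans_le (h.1.trans h.2)
    exact (pos_of_mul_pos_left h1 (Real.exp_pos _).le).le
  -- Saturating `t i` under equality of the first `n i` letters makes it open without adding initial
  -- words of that length, so compactness gives a finite subcover.
  set V : ℕ → Set (Shift A) := fun i => initialWord A (n i) ⁻¹' (initialWord A (n i) '' t i)
  have hV : ∀ i, IsOpen (V i) := fun i => (isOpen_discrete _).preimage (continuous_initialWord _)
  have hcov : (univ : Set (Shift A)) ⊆ ⋃ i, V i := by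
    rw [← ht]
    exact iUnion_mono fun i => subset_preimage_image _ _
  obtain ⟨F, hF⟩ := isCompact_univ.elim_finite_subcover V hV hcov
  set M := F.sup n
  -- The finitely many sets are compared at the common length `M`: each of the at most three initial
  -- words has at most `wordCount A (M - n i)` continuations. Dividing the total by `exp (M * L)`
  -- gives the claim.
  have hcount : ∀ i ∈ F, ((initialWord A M '' V i).ncard : ℝ) ≤
      3 * C * Real.exp ((M - n i) * L) := by
    intro i hi
    have hle : n i ≤ M := Finset.le_sup hi
    obtain ⟨k, hk⟩ := Nat.exists_eq_add_of_le hle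
    have h1 := ncard_image_initialWord_add_le (V i) (n i) k
    have h2 : (initialWord A (n i) '' V i).ncard ≤ 3 := by
      refine (ncard_le_ncard ?_ (toFinite _)).trans (hn i)
      exact image_preimage_subset _ _
    have h3 : (initialWord A M '' V i).ncard ≤ 3 * wordCount A k := by
      rw [hk]
      exact h1.trans (Nat.mul_le_mul_right _ h2)
    have h4 : ((M : ℝ) - n i) = k := by
      rw [hk]
      push_cast
      ring
    rw [h4, mul_assoc]
    calc ((initialWord A M '' V i).ncard : ℝ) ≤ ((3 * wordCount A k : ℕ) : ℝ) := by
          exact_mod_cast h3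
      _ = 3 * (wordCount A k : ℝ) := by push_cast; ring
      _ ≤ _ := mul_le_mul_of_nonneg_left (hL k).2 (by norm_num)
  have hsum : Real.exp (M * L) ≤ ∑ i ∈ F, 3 * C * Real.exp ((M - n i) * L) := by
    refine (hL M).1.trans ?_
    have hun : wordCount A M ≤ ∑ i ∈ F, (initialWord A M '' V i).ncard := by
      have h1 : range (initialWord A M) ⊆ ⋃ i ∈ F, initialWord A M '' V i := by
        rw [← image_univ, ← image_iUnion₂]
        exact image_mono hF
      exact (ncard_le_ncard h1 (toFinite _)).trans (Finset.set_ncard_biUnion_le _ _)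
    calc (wordCount A M : ℝ) ≤ ((∑ i ∈ F, (initialWord A M '' V i).ncard : ℕ) : ℝ) := by
          exact_mod_cast hun
      _ = ∑ i ∈ F, ((initialWord A M '' V i).ncard : ℝ) := by push_cast; rfl
      _ ≤ _ := Finset.sum_le_sum hcount
  have hfin : 1 ≤ ∑ i ∈ F, 3 * C * Real.exp (-(n i * L)) := by
    have h1 : ∑ i ∈ F, 3 * C * Real.exp ((M - n i) * L) =
        Real.exp (M * L) * ∑ i ∈ F, 3 * C * Real.exp (-(n i * L)) := by
      rw [Finset.mul_sum]
      refine Finset.sum_congr rfl fun i _ => ?_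
      rw [sub_mul, sub_eq_add_neg, Real.exp_add]
      ring
    rw [h1] at hsum
    exact le_of_mul_le_mul_left (by linarith) (Real.exp_pos (M * L))
  calc (1 : ℝ≥0∞) = ENNReal.ofReal 1 := ENNReal.ofReal_one.symm
    _ ≤ ENNReal.ofReal (∑ i ∈ F, 3 * C * Real.exp (-(n i * L))) := ENNReal.ofReal_le_ofReal hfin
    _ = ∑ i ∈ F, ENNReal.ofReal (3 * C * Real.exp (-(n i * L))) :=
        ENNReal.ofReal_sum_of_nonneg fun i _ =>
          mul_nonneg (mul_nonneg (by norm_num) hC) (Real.exp_pos _).le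
    _ ≤ _ := ENNReal.sum_le_tsum F

/-- A set of diameter at most `1` is small at a scale `N ^ (-n)` of comparable mass. -/
lemma exists_scale (hN : 2 ≤ N) {s : ℝ} (hs : 0 < s) (d : ℝ≥0∞) (hd : d ≤ 1) {ε : ℝ≥0∞}
    (hε : 0 < ε) :
    ∃ n : ℕ, d ≤ ENNReal.ofReal ((N : ℝ) ^ n)⁻¹ ∧
      ENNReal.ofReal (Real.exp (-(n * (s * Real.log N)))) ≤
        ENNReal.ofReal (Real.exp (s * Real.log N)) * d ^ s + ε := by
  have hN0 : (0 : ℝ) < N := by exact_mod_cast (by omega : 0 < N)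
  have hN1 : (1 : ℝ) < N := by exact_mod_cast (by omega : 1 < N)
  have hlog : 0 < Real.log N := Real.log_pos hN1
  have hdt : d ≠ ⊤ := (hd.trans_lt ENNReal.one_lt_top).ne
  rcases eq_or_ne d 0 with rfl | hd0
  -- Diameter zero singles out no scale; `n` is taken so large that `ε` pays for the mass.
  · have ht : Filter.Tendsto (fun n : ℕ => ENNReal.ofReal (Real.exp (-(n * (s * Real.log N)))))
        Filter.atTop (nhds 0) := by
      rw [← ENNReal.ofReal_zero]
      refine (ENNReal.continuous_ofReal.tendsto 0).comp ?_
      refine Real.tendsto_exp_neg_atTop_nhds_zero.comp ?_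
      exact tendsto_natCast_atTop_atTop.atTop_mul_const (mul_pos hs hlog)
    obtain ⟨n, hn⟩ := (ht.eventually (gt_mem_nhds hε)).exists
    exact ⟨n, zero_le, hn.le.trans le_add_self⟩
  · have hr0 : 0 < d.toReal := ENNReal.toReal_pos hd0 hdt
    have hr1 : d.toReal ≤ 1 := by
      simpa using ENNReal.toReal_mono ENNReal.one_ne_top hd
    -- Here `N ^ (-(n + 1)) < d ≤ N ^ (-n)`; the factor `exp (s * log N) = N ^ s` is the loss of one
    -- scale.
    obtain ⟨n, hn1, hn2⟩ := exists_nat_pow_near_of_lt_one hr0 hr1 (inv_pos.2 hN0)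
      (inv_lt_one_of_one_lt₀ hN1)
    refine ⟨n, ?_, ?_⟩
    · rw [← inv_pow]
      exact ENNReal.le_ofReal_iff_toReal_le hdt (by positivity) |>.2 hn2
    · refine le_trans ?_ le_self_add
      rw [← ENNReal.ofReal_toReal hdt, ENNReal.ofReal_rpow_of_pos hr0,
        ← ENNReal.ofReal_mul (Real.exp_pos _).le]
      refine ENNReal.ofReal_le_ofReal ?_
      have h1 : ((N : ℝ)⁻¹ ^ (n + 1)) ^ s ≤ d.toReal ^ s :=
        Real.rpow_le_rpow (by positivity) hn1.le hs.le
      have h2 : ((N : ℝ)⁻¹ ^ (n + 1)) ^ s = Real.exp (-((n + 1) * (s * Real.log N))) := by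
        rw [Real.rpow_def_of_pos (by positivity), Real.log_pow, Real.log_inv]
        congr 1
        push_cast
        ring
      calc Real.exp (-(n * (s * Real.log N)))
          = Real.exp (s * Real.log N) * Real.exp (-((n + 1) * (s * Real.log N))) := by
            rw [← Real.exp_add]
            congr 1
            ring
        _ ≤ _ := by
            rw [← h2]
            exact mul_le_mul_of_nonneg_left h1 (Real.exp_pos _).le

end CKWavelet

/-! ### Positivity and finiteness of the Hausdorff measure. -/

namespace CKWavelet

open scoped Pointwise
variable {N : ℕ} {A : Matrix (Fin N) (Fin N) ℕ}

/-- The cylinders of length `n` are `wordCount A n` sets of diameter at most `N ^ (-n)`, so their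
sum of `s`-th powers is at most `C` for every `n`. -/
lemma hausdorffMeasure_range_value_ne_top (hN : 2 ≤ N) {s C : ℝ} (hs : 0 < s)
    (hL : ∀ n : ℕ, (wordCount A n : ℝ) ≤ C * Real.exp (n * (s * Real.log N))) :
    Measure.hausdorffMeasure s (range (value A)) ≠ ⊤ := by
  classical
  have hN0 : (0 : ℝ) < N := by exact_mod_cast (by omega : 0 < N)
  have hN1 : (1 : ℝ) < N := by exact_mod_cast (by omega : 1 < N)
  have hdiam : ∀ (n : ℕ) (g : range (initialWord A n)),
      Metric.ediam (value A '' (initialWord A n ⁻¹' {g.1})) ≤ ENNReal.ofReal ((N : ℝ) ^ n)⁻¹ := by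
    rintro n ⟨g, hg⟩
    refine Metric.ediam_le ?_
    rintro _ ⟨w, hw, rfl⟩ _ ⟨w', hw', rfl⟩
    rw [edist_dist, Real.dist_eq]
    refine ENNReal.ofReal_le_ofReal (abs_value_sub_le ?_)
    rw [mem_preimage, mem_singleton_iff] at hw hw'
    rw [hw, hw']
  have hr : Filter.Tendsto (fun n : ℕ => ENNReal.ofReal ((N : ℝ) ^ n)⁻¹) Filter.atTop (nhds 0) := by
    rw [← ENNReal.ofReal_zero]
    refine (ENNReal.continuous_ofReal.tendsto 0).comp ?_
    exact tendsto_inv_atTop_zero.comp (tendsto_pow_atTop_atTop_of_one_lt hN1)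
  have hle := Measure.hausdorffMeasure_le_liminf_sum s (range (value A)) _ hr
    (fun n (g : range (initialWord A n)) => value A '' (initialWord A n ⁻¹' {g.1}))
    (Filter.Eventually.of_forall hdiam) (Filter.Eventually.of_forall fun n => by
      rintro _ ⟨w, rfl⟩
      exact mem_iUnion.2 ⟨⟨initialWord A n w, w, rfl⟩, w, rfl, rfl⟩)
  refine ((hle.trans ?_).trans_lt (ENNReal.ofReal_lt_top (r := C))).ne
  refine Filter.liminf_le_of_frequently_le' (Filter.Frequently.of_forall fun n => ?_)
  have hcard : ((Finset.univ : Finset (range (initialWord A n))).card) = wordCount A n := by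
    rw [Finset.card_univ, wordCount, ← Nat.card_coe_set_eq, Nat.card_eq_fintype_card]
  calc ∑ g : range (initialWord A n), Metric.ediam (value A '' (initialWord A n ⁻¹' {g.1})) ^ s
      ≤ ∑ g : range (initialWord A n), ENNReal.ofReal ((N : ℝ) ^ n)⁻¹ ^ s :=
        Finset.sum_le_sum fun g _ => ENNReal.rpow_le_rpow (hdiam n g) hs.le
    _ = ENNReal.ofReal (wordCount A n * Real.exp (-(n * (s * Real.log N)))) := by
        rw [Finset.sum_const, hcard, nsmul_eq_mul, ENNReal.ofReal_mul (Nat.cast_nonneg _),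
          ENNReal.ofReal_natCast, ENNReal.ofReal_rpow_of_pos (by positivity),
          Real.rpow_def_of_pos (by positivity), Real.log_inv, Real.log_pow]
        congr 3
        ring
    _ ≤ ENNReal.ofReal C := by
        refine ENNReal.ofReal_le_ofReal ?_
        rw [Real.exp_neg, ← div_eq_mul_inv, div_le_iff₀ (Real.exp_pos _)]
        exact hL n

/-- Each set of a cover is replaced by the at most three words it meets at its own scale. The lower
bound on the total mass of these words then bounds the sum of the `diam ^ s` below by `1 / (3 * C *
N ^ s)`. -/
lemma hausdorffMeasure_range_value_ne_zero (hN : 2 ≤ N) {s C : ℝ} (hs : 0 < s) (hC : 0 < C)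
    (hL : ∀ n : ℕ, Real.exp (n * (s * Real.log N)) ≤ wordCount A n ∧
      (wordCount A n : ℝ) ≤ C * Real.exp (n * (s * Real.log N))) :
    Measure.hausdorffMeasure s (range (value A)) ≠ 0 := by
  set lam : ℝ≥0∞ := ENNReal.ofReal (Real.exp (s * Real.log N)) with hlam
  set c : ℝ≥0∞ := ENNReal.ofReal (3 * C) with hc
  have hc0 : c ≠ 0 := (ENNReal.ofReal_pos.2 (by positivity)).ne'
  have hct : c ≠ ⊤ := ENNReal.ofReal_ne_top
  have hcover : ∀ t : ℕ → Set ℝ, range (value A) ⊆ ⋃ n, t n → (∀ n, Metric.ediam (t n) ≤ 1) →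
      1 ≤ c * lam * ∑' n, ⨆ _ : (t n).Nonempty, Metric.ediam (t n) ^ s := by
    intro t ht hd
    refine ENNReal.le_of_forall_pos_le_add fun ε hε _ => ?_
    -- Sets of diameter zero need errors `e i`, chosen so that they total at most `ε` after
    -- multiplication by `c`.
    obtain ⟨e, he0, hesum⟩ := ENNReal.exists_pos_sum_of_countable
      (ENNReal.div_pos (ENNReal.coe_pos.2 hε).ne' hct).ne' ℕ
    choose n hn1 hn2 using fun i =>
      exists_scale hN hs (Metric.ediam (t i)) (hd i) (ENNReal.coe_pos.2 (he0 i))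
    have hcov : ⋃ i, value A ⁻¹' t i = univ := by
      rw [← preimage_iUnion, eq_univ_iff_forall]
      exact fun w => ht ⟨w, rfl⟩
    have h1 := one_le_tsum_of_cover hL (fun i => value A ⁻¹' t i) hcov n fun i => by
      refine ncard_initialWord_le_three fun w hw w' hw' => ?_
      have h := (Metric.edist_le_ediam_of_mem (show value A w ∈ t i from hw)
        (show value A w' ∈ t i from hw')).trans (hn1 i)
      rw [edist_dist, Real.dist_eq] at h
      exact (ENNReal.ofReal_le_ofReal_iff (by positivity)).1 h
    refine h1.trans ?_
    have h2 : ∀ i, ENNReal.ofReal (3 * C * Real.exp (-(n i * (s * Real.log N)))) ≤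
        c * lam * (⨆ _ : (t i).Nonempty, Metric.ediam (t i) ^ s) + c * e i := by
      intro i
      rw [ENNReal.ofReal_mul (by positivity), mul_assoc, ← mul_add]
      refine mul_le_mul_right ((hn2 i).trans ?_) _
      gcongr
      rcases (t i).eq_empty_or_nonempty with h | h
      · rw [h, Metric.ediam_empty, ENNReal.zero_rpow_of_pos hs]
        exact zero_le
      · exact le_iSup_of_le h le_rfl
    refine (ENNReal.tsum_le_tsum h2).trans ?_
    rw [ENNReal.tsum_add, ENNReal.tsum_mul_left, ENNReal.tsum_mul_left]
    gcongr
    calc c * ∑' i, (e i : ℝ≥0∞) ≤ c * (ε / c) := by gcongr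
      _ = ε := ENNReal.mul_div_cancel hc0 hct
  intro h0
  have hbound : (c * lam)⁻¹ ≤ Measure.hausdorffMeasure s (range (value A)) := by
    rw [Measure.hausdorffMeasure_apply]
    -- The Hausdorff measure is a supremum over the mesh of the covers; mesh `1` already gives a
    -- positive bound.
    refine le_iSup₂_of_le 1 one_pos ?_
    refine le_iInf fun t => le_iInf fun ht => le_iInf fun hd => ?_
    have h := hcover t ht hd
    refine ENNReal.inv_le_iff_le_mul ?_ ?_ |>.2 h
    · exact fun _ => mul_ne_zero hc0 (ENNReal.ofReal_pos.2 (Real.exp_pos _)).ne'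
    · exact fun h => absurd h (ENNReal.mul_ne_top hct ENNReal.ofReal_ne_top)
  rw [h0, nonpos_iff_eq_zero, ENNReal.inv_eq_zero] at hbound
  exact ENNReal.mul_ne_top hct ENNReal.ofReal_ne_top hbound

/-- The Hausdorff measure of `Λ_A` in its dimension is positive and finite, and the dimension is
positive if there are at least two letters. -/
theorem hausdorffMeasure_hdim (h01 : ∀ i j, A i j = 0 ∨ A i j = 1) (hdiag : ∀ i, A i i = 1)
    (hirr : ∃ n : ℕ, ∀ i j, 0 < (A ^ n) i j) (hN : 2 ≤ N) :
    0 < hdim A ∧ Measure.hausdorffMeasure (hdim A) (range (value A)) ≠ 0 ∧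
      Measure.hausdorffMeasure (hdim A) (range (value A)) ≠ ⊤ := by
  have hne : Nonempty (Shift A) := ⟨⟨fun _ => ⟨0, by omega⟩, fun _ => hdiag _⟩⟩
  obtain ⟨L, C, hC, hL⟩ := exists_growth_rate h01 hirr
  have hN1 : (1 : ℝ) < N := by exact_mod_cast (by omega : 1 < N)
  have hlog : 0 < Real.log N := Real.log_pos hN1
  have hL0 : 0 < L := by
    by_contra hle
    rw [not_lt] at hle
    obtain ⟨n, hn⟩ := exists_nat_gt C
    have h1 : ((n + 1 : ℕ) : ℝ) ≤ wordCount A n := by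
      exact_mod_cast succ_le_wordCount h01 hdiag hirr hN n
    have h2 : Real.exp (n * L) ≤ 1 :=
      Real.exp_le_one_iff.2 (mul_nonpos_of_nonneg_of_nonpos n.cast_nonneg hle)
    have h3 := (hL n).2
    have h4 : C * Real.exp (n * L) ≤ C * 1 := mul_le_mul_of_nonneg_left h2 hC.le
    push_cast at h1
    linarith
  -- This is the exponent with `N ^ (n * s) = exp (n * L)`. A dimension in which the measure is
  -- neither `0` nor `⊤` is the Hausdorff dimension.
  set s : ℝ := L / Real.log N with hs
  have hs0 : 0 < s := div_pos hL0 hlog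
  have hsL : s * Real.log N = L := div_mul_cancel₀ _ hlog.ne'
  rw [← hsL] at hL
  have h0 := hausdorffMeasure_range_value_ne_zero hN hs0 hC hL
  have ht := hausdorffMeasure_range_value_ne_top hN hs0 fun n => (hL n).2
  have hd : hdim A = s := by
    have := dimH_of_hausdorffMeasure_ne_zero_ne_top (d := s.toNNReal) (s := range (value A))
      (by rwa [Real.coe_toNNReal _ hs0.le]) (by rwa [Real.coe_toNNReal _ hs0.le])
    rw [hdim, this, ENNReal.coe_toReal, Real.coe_toNNReal _ hs0.le]
  rw [hd]
  exact ⟨hs0, h0, ht⟩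

lemma subsingleton_shift (hN : N < 2) : Subsingleton (Shift A) :=
  have : Subsingleton (Fin N) := Fin.subsingleton_iff_le_one.2 (by omega)
  inferInstance

lemma hdim_of_lt_two (hN : N < 2) : hdim A = 0 := by
  have := subsingleton_shift (A := A) hN
  rw [hdim, (subsingleton_range (value A)).dimH_zero, ENNReal.toReal_zero]

/-- `μ_A(E) = H^{δ_A}(value(E))`, in every dimension. -/
theorem mu_eq (h01 : ∀ i j, A i j = 0 ∨ A i j = 1) (hdiag : ∀ i, A i i = 1)
    (hirr : ∃ n : ℕ, ∀ i j, 0 < (A ^ n) i j) {E : Set (Shift A)} (hE : MeasurableSet E) :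
    mu A E = Measure.hausdorffMeasure (X := ℝ) (hdim A) (value A '' E) := by
  rcases le_or_gt 2 N with hN | hN
  · exact mu_apply A (hausdorffMeasure_hdim h01 hdiag hirr hN).1 hE
  -- Here `δ_A = 0`, but there is at most one word, so every set is empty or everything and the
  -- default value in `mu` is not used.
  · have := subsingleton_shift (A := A) hN
    have h : (inferInstance : MeasurableSpace (Shift A)) ≤ (hausdorffOuter A).caratheodory := by
      intro E _
      rcases E.eq_empty_or_nonempty with rfl | hne
      · exact @MeasurableSet.empty _ (hausdorffOuter A).caratheodory
      · rw [Subsingleton.eq_univ_of_nonempty hne]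
        exact @MeasurableSet.univ _ (hausdorffOuter A).caratheodory
    rw [mu, dif_pos h, toMeasure_apply _ _ hE]
    rfl

theorem hausdorffMeasure_range_value (h01 : ∀ i j, A i j = 0 ∨ A i j = 1) (hdiag : ∀ i, A i i = 1)
    (hirr : ∃ n : ℕ, ∀ i j, 0 < (A ^ n) i j) :
    (Nonempty (Shift A) → Measure.hausdorffMeasure (hdim A) (range (value A)) ≠ 0) ∧
      Measure.hausdorffMeasure (hdim A) (range (value A)) ≠ ⊤ := by
  rcases le_or_gt 2 N with hN | hN
  · exact ⟨fun _ => (hausdorffMeasure_hdim h01 hdiag hirr hN).2.1,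
      (hausdorffMeasure_hdim h01 hdiag hirr hN).2.2⟩
  · have := subsingleton_shift (A := A) hN
    rw [hdim_of_lt_two hN]
    rcases (subsingleton_range (value A)).eq_empty_or_singleton with h | ⟨x, h⟩
    · rw [h]
      refine ⟨fun hne => absurd h (range_nonempty _).ne_empty, by simp⟩
    · rw [h, Measure.hausdorffMeasure_zero_singleton]
      exact ⟨fun _ => one_ne_zero, ENNReal.one_ne_top⟩

theorem isFiniteMeasure_mu (h01 : ∀ i j, A i j = 0 ∨ A i j = 1) (hdiag : ∀ i, A i i = 1)
    (hirr : ∃ n : ℕ, ∀ i j, 0 < (A ^ n) i j) : IsFiniteMeasure (mu A) := by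
  refine ⟨?_⟩
  rw [mu_eq h01 hdiag hirr MeasurableSet.univ, image_univ]
  exact (hausdorffMeasure_range_value h01 hdiag hirr).2.lt_top

theorem mu_univ_ne_zero [Nonempty (Shift A)] (h01 : ∀ i j, A i j = 0 ∨ A i j = 1)
    (hdiag : ∀ i, A i i = 1) (hirr : ∃ n : ℕ, ∀ i j, 0 < (A ^ n) i j) : mu A univ ≠ 0 := by
  rw [mu_eq h01 hdiag hirr MeasurableSet.univ, image_univ]
  exact (hausdorffMeasure_range_value h01 hdiag hirr).1 inferInstance

/-! ### The branches `σ_i` and the self-similarity of `μ_A`. -/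

lemma measurableSet_cylinder (a : List (Fin N)) : MeasurableSet (cylinder A a) := by
  have : cylinder A a = ⋂ (n : ℕ) (h : n < a.length), (fun w : Shift A => w.1 n) ⁻¹' {a[n]} := by
    ext w
    simp [cylinder]
  rw [this]
  refine MeasurableSet.iInter fun n => MeasurableSet.iInter fun h => ?_
  exact ((measurable_pi_apply n).comp measurable_subtype_coe) (measurableSet_singleton _)

lemma measurableSet_dom (i : Fin N) : MeasurableSet (dom A i) :=
  ((measurable_pi_apply 0).comp measurable_subtype_coe :
    Measurable fun w : Shift A => w.1 0) (t := {j : Fin N | A i j = 1}) (MeasurableSet.of_discrete)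

lemma measurable_shift : Measurable (shift A) := by
  refine Measurable.subtype_mk (measurable_pi_lambda _ fun n => ?_)
  exact (measurable_pi_apply (n + 1)).comp measurable_subtype_coe

lemma measurable_branch (i : Fin N) : Measurable (branch A i) := by
  refine Measurable.subtype_mk (measurable_pi_lambda _ fun n => ?_)
  cases n with
  | zero => exact measurable_const
  | succ n => exact ((measurable_pi_apply n).comp measurable_subtype_coe).comp measurable_subtype_coe

lemma shift_branch (i : Fin N) (w : dom A i) : shift A (branch A i w) = w.1 := rfl

lemma mem_cylinder_singleton {i : Fin N} {w : Shift A} : w ∈ cylinder A [i] ↔ w.1 0 = i := by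
  simp [cylinder]

lemma shift_mem_dom {i : Fin N} {w : Shift A} (h : w ∈ cylinder A [i]) : shift A w ∈ dom A i := by
  have h1 := w.2 0
  rw [mem_cylinder_singleton.1 h] at h1
  exact h1

lemma branch_shift {i : Fin N} {w : Shift A} (h : w ∈ cylinder A [i]) :
    branch A i ⟨shift A w, shift_mem_dom h⟩ = w := by
  refine Subtype.ext (funext fun n => ?_)
  cases n with
  | zero => exact (mem_cylinder_singleton.1 h).symm
  | succ n => rfl

lemma branch_mem_cylinder (i : Fin N) (w : dom A i) : branch A i w ∈ cylinder A [i] :=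
  mem_cylinder_singleton.2 rfl

lemma branch_image (i : Fin N) (E : Set (Shift A)) :
    branch A i '' (Subtype.val ⁻¹' E) = cylinder A [i] ∩ shift A ⁻¹' E := by
  ext w
  constructor
  · rintro ⟨v, hv, rfl⟩
    exact ⟨branch_mem_cylinder i v, hv⟩
  · rintro ⟨h1, h2⟩
    exact ⟨_, h2, branch_shift h1⟩

lemma measurableEmbedding_branch (i : Fin N) : MeasurableEmbedding (branch A i) where
  injective w w' h := Subtype.ext (by rw [← shift_branch i w, h, shift_branch])
  measurable := measurable_branch i
  measurableSet_image' := by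
    intro E hE
    obtain ⟨F, hF, rfl⟩ := hE
    rw [branch_image]
    exact (measurableSet_cylinder _).inter (measurable_shift hF)

lemma muBranch_apply (i : Fin N) {E : Set (Shift A)} (hE : MeasurableSet E) :
    muBranch A i E = mu A (cylinder A [i] ∩ shift A ⁻¹' E) := by
  rw [muBranch, Measure.map_apply measurable_subtype_coe hE,
    (measurableEmbedding_branch i).comap_apply, branch_image]

lemma value_eq_of_mem {i : Fin N} {w : Shift A} (h : w ∈ cylinder A [i]) :
    value A w = (N : ℝ)⁻¹ * value A (shift A w) + i * (N : ℝ)⁻¹ := by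
  have h1 := Real.ofDigits_eq_sum_add_ofDigits w.1 1
  change value A w = _ + _ * value A (shift A w) at h1
  rw [h1, Finset.sum_range_one, Real.ofDigitsTerm, mem_cylinder_singleton.1 h]
  simp [add_comm]

/-- The factor `N ^ (-δ_A)` by which the branches `σ_i` contract `μ_A`. -/
noncomputable def contraction (A : Matrix (Fin N) (Fin N) ℕ) : NNReal :=
  ‖(N : ℝ)⁻¹‖₊ ^ hdim A

lemma contraction_pos (i : Fin N) : 0 < contraction A := by
  have hN : (N : ℝ) ≠ 0 := by exact_mod_cast (Fin.pos i).ne'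
  exact NNReal.rpow_pos (nnnorm_pos.2 (inv_ne_zero hN))

/-- By `value_eq_of_mem`, `σ_i` acts on values as a homothety of ratio `1 / N` followed by a
translation. Hausdorff measure of dimension `δ_A` is translation invariant and scales by `N ^
(-δ_A)`. -/
theorem muBranch_eq (h01 : ∀ i j, A i j = 0 ∨ A i j = 1) (hdiag : ∀ i, A i i = 1)
    (hirr : ∃ n : ℕ, ∀ i j, 0 < (A ^ n) i j) (i : Fin N) :
    muBranch A i = contraction A • (mu A).restrict (dom A i) := by
  have hN : (N : ℝ)⁻¹ ≠ 0 := inv_ne_zero (by exact_mod_cast (Fin.pos i).ne')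
  ext E hE
  rw [muBranch_apply i hE, Measure.smul_apply, Measure.restrict_apply hE,
    mu_eq h01 hdiag hirr ((measurableSet_cylinder _).inter (measurable_shift hE)),
    mu_eq h01 hdiag hirr (hE.inter (measurableSet_dom i))]
  have himg : value A '' (cylinder A [i] ∩ shift A ⁻¹' E) =
      IsometryEquiv.addRight ((i : ℝ) * (N : ℝ)⁻¹) ''
        ((N : ℝ)⁻¹ • (value A '' (E ∩ dom A i))) := by
    ext x
    constructor
    · rintro ⟨w, ⟨hw, hE'⟩, rfl⟩
      exact ⟨_, ⟨_, ⟨shift A w, ⟨hE', shift_mem_dom hw⟩, rfl⟩, rfl⟩, (value_eq_of_mem hw).symm⟩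
    · rintro ⟨_, ⟨_, ⟨w, hw, rfl⟩, rfl⟩, rfl⟩
      refine ⟨branch A i ⟨w, hw.2⟩, ⟨branch_mem_cylinder _ _, hw.1⟩, ?_⟩
      exact value_eq_of_mem (branch_mem_cylinder _ _)
  rw [himg, IsometryEquiv.hausdorffMeasure_image,
    Measure.hausdorffMeasure_smul₀ (d := hdim A) ENNReal.toReal_nonneg hN]
  rfl

lemma mu_branch_image (h01 : ∀ i j, A i j = 0 ∨ A i j = 1) (hdiag : ∀ i, A i i = 1)
    (hirr : ∃ n : ℕ, ∀ i j, 0 < (A ^ n) i j) (i : Fin N) {E : Set (Shift A)}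
    (hE : MeasurableSet E) :
    mu A (cylinder A [i] ∩ shift A ⁻¹' E) = contraction A * mu A (E ∩ dom A i) := by
  rw [← muBranch_apply i hE, muBranch_eq h01 hdiag hirr, Measure.smul_apply,
    Measure.restrict_apply hE]
  rfl

/-- The `R_j` cover a space of positive measure, so one of them has positive measure. If `A k l =
1`, then `R_k` contains `σ_k(R_l)`, so positivity travels backwards along a path from `i` to `j`. -/
theorem mu_cylinder_singleton_ne_zero (h01 : ∀ i j, A i j = 0 ∨ A i j = 1)
    (hdiag : ∀ i, A i i = 1) (hirr : ∃ n : ℕ, ∀ i j, 0 < (A ^ n) i j) (i : Fin N) :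
    mu A (cylinder A [i]) ≠ 0 := by
  have hne : Nonempty (Shift A) := ⟨⟨fun _ => i, fun _ => hdiag _⟩⟩
  obtain ⟨j, hj⟩ : ∃ j, mu A (cylinder A [j]) ≠ 0 := by
    by_contra! hc
    refine mu_univ_ne_zero h01 hdiag hirr (measure_mono_null (t := ⋃ j, cylinder A [j]) ?_
      (measure_iUnion_null hc))
    exact fun w _ => mem_iUnion.2 ⟨w.1 0, mem_cylinder_singleton.2 rfl⟩
  have hstep : ∀ k l, A k l = 1 → mu A (cylinder A [l]) ≠ 0 → mu A (cylinder A [k]) ≠ 0 := by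
    intro k l hkl hl h0
    have h1 := mu_branch_image h01 hdiag hirr k (measurableSet_cylinder (A := A) [l])
    rw [measure_mono_null inter_subset_left h0, inter_eq_left.2, eq_comm, mul_eq_zero] at h1
    · rcases h1 with h1 | h1
      · exact (contraction_pos i).ne' (ENNReal.coe_eq_zero.1 h1)
      · exact hl h1
    · intro w hw
      change A k (w.1 0) = 1
      rw [mem_cylinder_singleton.1 hw, hkl]
  obtain ⟨q, hq⟩ := hirr
  obtain ⟨u, hu0, huq, hu⟩ := exists_path_of_pow_pos h01 q i j (hq i j)
  have : ∀ n ≤ q, mu A (cylinder A [u (q - n)]) ≠ 0 := by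
    intro n
    induction n with
    | zero => intro _; rwa [Nat.sub_zero, huq]
    | succ n ih =>
      intro hn
      refine hstep _ (u (q - n)) ?_ (ih (by omega))
      have := hu (q - (n + 1)) (by omega)
      rwa [show q - (n + 1) + 1 = q - n by omega] at this
  simpa [hu0] using this q le_rfl

end CKWavelet

/-! ### Cylinders and the explicit form of the wavelets. -/

namespace CKWavelet

variable {N : ℕ} {A : Matrix (Fin N) (Fin N) ℕ}

/-- The list of the first `n` letters of a word. -/
def letters {N : ℕ} {A : Matrix (Fin N) (Fin N) ℕ} (n : ℕ) (w : Shift A) : List (Fin N) :=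
  (List.range n).map w.1

@[simp] lemma length_letters (n : ℕ) (w : Shift A) : (letters n w).length = n := by
  simp [letters]

lemma letters_succ (n : ℕ) (w : Shift A) : letters (n + 1) w = letters n w ++ [w.1 n] := by
  simp [letters, List.range_succ]

lemma letters_succ' (n : ℕ) (w : Shift A) :
    letters (n + 1) w = w.1 0 :: letters n (shift A w) := by
  simp [letters, List.range_succ_eq_map, shift, Function.comp_def]

lemma admissible_letters (n : ℕ) (w : Shift A) : Admissible A (letters n w) := by
  rw [Admissible, letters, List.isChain_map, List.isChain_range]
  exact fun m _ => w.2 m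

lemma mem_cylinder_iff {a : List (Fin N)} {w : Shift A} :
    w ∈ cylinder A a ↔ letters a.length w = a := by
  constructor
  · intro h
    refine List.ext_getElem (by simp) fun n h1 h2 => ?_
    simpa [letters] using h n h2
  · intro h n hn
    have : (letters a.length w)[n]'(by simpa using hn) = a[n] := by simp only [h]
    simpa [letters] using this

lemma mem_cylinder_letters (n : ℕ) (w : Shift A) : w ∈ cylinder A (letters n w) := by
  rw [mem_cylinder_iff, length_letters]

lemma admissible_of_mem {a : List (Fin N)} {w : Shift A} (h : w ∈ cylinder A a) :
    Admissible A a := by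
  rw [← mem_cylinder_iff.1 h]
  exact admissible_letters _ _

lemma cylinder_eq_empty {a : List (Fin N)} (h : ¬ Admissible A a) : cylinder A a = ∅ :=
  eq_empty_of_forall_notMem fun _ hw => h (admissible_of_mem hw)

lemma disjoint_cylinder {a b : List (Fin N)} (hl : a.length = b.length) (hne : a ≠ b) :
    Disjoint (cylinder A a) (cylinder A b) := by
  rw [Set.disjoint_left]
  intro w ha hb
  rw [mem_cylinder_iff] at ha hb
  rw [hl] at ha
  exact hne (ha.symm.trans hb)

lemma mem_cylinder_append_singleton {a : List (Fin N)} {j : Fin N} {w : Shift A} :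
    w ∈ cylinder A (a ++ [j]) ↔ w ∈ cylinder A a ∧ w.1 a.length = j := by
  rw [mem_cylinder_iff, mem_cylinder_iff, List.length_append, List.length_singleton, letters_succ]
  constructor
  · intro h
    have := List.append_inj h (by simp)
    exact ⟨this.1, by simpa using this.2⟩
  · rintro ⟨h1, h2⟩
    rw [h1, h2]

lemma mem_cylinder_cons {a : List (Fin N)} {i : Fin N} {w : Shift A} :
    w ∈ cylinder A (i :: a) ↔ w ∈ cylinder A [i] ∧ shift A w ∈ cylinder A a := by
  rw [mem_cylinder_singleton, mem_cylinder_iff, mem_cylinder_iff, List.length_cons, letters_succ',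
    List.cons.injEq]

lemma cylinder_append_subset (a b : List (Fin N)) : cylinder A (a ++ b) ⊆ cylinder A a := by
  intro w hw n hn
  rw [hw n (by rw [List.length_append]; omega), List.getElem_append_left hn]

lemma cylinder_nil : cylinder A [] = univ := by
  ext w
  simp [cylinder]

lemma shift_mem_cylinder_dom {i j : Fin N} (a : List (Fin N)) (h : A i j = 1) :
    cylinder A (j :: a) ⊆ dom A i := by
  intro w hw
  have h0 : w.1 0 = j := mem_cylinder_singleton.1 (mem_cylinder_cons.1 hw).1
  change A i (w.1 0) = 1
  rw [h0, h]

/-- `μ_A` is finite and positive on the `R_i`, and is contracted by the factor `q` by the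
branches `σ_i`. -/
structure IsSelfSimilar {N : ℕ} (A : Matrix (Fin N) (Fin N) ℕ) (q : NNReal) : Prop where
  isFiniteMeasure : IsFiniteMeasure (mu A)
  pos : 0 < q
  muBranch_eq : ∀ i, muBranch A i = q • (mu A).restrict (dom A i)
  mu_ne_zero : ∀ i, mu A (cylinder A [i]) ≠ 0

theorem isSelfSimilar (h01 : ∀ i j, A i j = 0 ∨ A i j = 1) (hdiag : ∀ i, A i i = 1)
    (hirr : ∃ n : ℕ, ∀ i j, 0 < (A ^ n) i j) : IsSelfSimilar A (contraction A) where
  isFiniteMeasure := isFiniteMeasure_mu h01 hdiag hirr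
  pos := by
    rcases Nat.eq_zero_or_pos N with rfl | hN
    -- Without letters the factor is `0 ^ 0 = 1`.
    · rw [contraction, hdim_of_lt_two (by omega), NNReal.rpow_zero]
      exact one_pos
    · exact contraction_pos ⟨0, hN⟩
  muBranch_eq := muBranch_eq h01 hdiag hirr
  mu_ne_zero := mu_cylinder_singleton_ne_zero h01 hdiag hirr

namespace IsSelfSimilar

variable {q : NNReal}

lemma mu_inter_shift (h : IsSelfSimilar A q) (i : Fin N) {E : Set (Shift A)}
    (hE : MeasurableSet E) :
    mu A (cylinder A [i] ∩ shift A ⁻¹' E) = q * mu A (E ∩ dom A i) := by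
  rw [← muBranch_apply i hE, h.muBranch_eq, Measure.smul_apply, Measure.restrict_apply hE]
  rfl

/-- Each letter of `a` contributes a factor `q`. The word `b` must have a first letter:
admissibility then puts the whole cylinder in the domain of the branch, whereas for empty `b` only
the part in `D_i` would count. -/
lemma mu_cylinder_append (h : IsSelfSimilar A q) {b : List (Fin N)} (hb : b ≠ []) :
    ∀ a : List (Fin N), Admissible A (a ++ b) →
      mu A (cylinder A (a ++ b)) = q ^ a.length * mu A (cylinder A b)
  | [], _ => by simp
  | i :: a, hab => by
    have hab' : Admissible A (i :: (a ++ b)) := hab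
    obtain ⟨j, t, hjt⟩ := List.exists_cons_of_ne_nil (List.append_ne_nil_of_right_ne_nil a hb)
    have hij : A i j = 1 := (List.isChain_cons.1 hab').1 j (by simp [hjt])
    have ih := h.mu_cylinder_append hb a (List.isChain_cons.1 hab').2
    have hset : cylinder A (i :: a ++ b) = cylinder A [i] ∩ shift A ⁻¹' cylinder A (a ++ b) :=
      ext fun w => mem_cylinder_cons
    rw [hset, h.mu_inter_shift i (measurableSet_cylinder _), inter_eq_left.2, ih, List.length_cons,
      pow_succ', mul_assoc]
    rw [hjt]
    exact shift_mem_cylinder_dom t hij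

lemma mu_cylinder_ne_zero (h : IsSelfSimilar A q) {a : List (Fin N)} {r : Fin N}
    (ha : Admissible A (a ++ [r])) : mu A (cylinder A (a ++ [r])) ≠ 0 := by
  rw [h.mu_cylinder_append (List.cons_ne_nil _ _) a ha]
  exact mul_ne_zero (pow_ne_zero _ (ENNReal.coe_ne_zero.2 h.pos.ne')) (h.mu_ne_zero r)

/-- The image of `μ` restricted to `R_i` under `σ` is `μ ∘ σ_i`, which is absolutely continuous.
This lets `S_i` act on classes of functions although `Φ_{σ_i}` is known only almost everywhere. -/
lemma ae_shift (h : IsSelfSimilar A q) (i : Fin N) {P : Shift A → Prop}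
    (hP : ∀ᵐ w ∂(mu A), P w) : ∀ᵐ w ∂(mu A), w ∈ cylinder A [i] → P (shift A w) := by
  rw [← ae_restrict_iff' (measurableSet_cylinder _)]
  refine ae_of_ae_map measurable_shift.aemeasurable ?_
  have hmap : ((mu A).restrict (cylinder A [i])).map (shift A) =
      q • (mu A).restrict (dom A i) := by
    rw [← h.muBranch_eq]
    ext E hE
    rw [muBranch_apply i hE, Measure.map_apply measurable_shift hE,
      Measure.restrict_apply (measurable_shift hE), inter_comm]
  rw [hmap]
  have hac : q • (mu A).restrict (dom A i) ≪ mu A :=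
    (Measure.smul_absolutelyContinuous).trans Measure.restrict_le_self.absolutelyContinuous
  exact hac.ae_le hP

/-- The density is `q` times the indicator of `D_i`. Restricting to `D_i` loses nothing, since `S_i`
uses it only at `σ(x)` with `x ∈ R_i`. -/
lemma Phi_ae_eq (h : IsSelfSimilar A q) (i : Fin N) :
    ∀ᵐ w ∂(mu A), w ∈ dom A i → Phi A i w = q := by
  have := h.isFiniteMeasure
  have hd : muBranch A i = (mu A).withDensity ((dom A i).indicator fun _ => (q : ℝ≥0∞)) := by
    rw [withDensity_indicator (measurableSet_dom i), withDensity_const, h.muBranch_eq]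
    rfl
  have hr := Measure.rnDeriv_withDensity (mu A)
    (measurable_const (a := (q : ℝ≥0∞)) |>.indicator (measurableSet_dom (A := A) i))
  filter_upwards [hr] with w hw hwd
  rw [Phi, hd, hw, indicator_of_mem hwd, ENNReal.coe_toReal]

lemma S_ae_eq (h : IsSelfSimilar A q) (i : Fin N) {ψ φ : Shift A → ℂ} (hψ : ψ =ᵐ[mu A] φ) :
    S A i ψ =ᵐ[mu A] (cylinder A [i]).indicator
      fun w => (((q : ℝ) ^ (-(1 / 2) : ℝ) : ℝ) : ℂ) * φ (shift A w) := by
  filter_upwards [h.ae_shift i hψ, h.ae_shift i (h.Phi_ae_eq i)] with w h1 h2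
  by_cases hw : w ∈ cylinder A [i]
  · rw [S, indicator_of_mem hw, indicator_of_mem hw, h1 hw, h2 hw (shift_mem_dom hw)]
  · rw [S, indicator_of_notMem hw, indicator_of_notMem hw]

/-- The wavelet `S_a f^{ℓ,r}` as a linear combination of characteristic functions. -/
lemma SWord_mother_ae_eq (h : IsSelfSimilar A q)
    (c : (r : Fin N) → Fin (outDegree A r - 1) → Fin N → ℂ) (r : Fin N)
    (l : Fin (outDegree A r - 1)) (a : List (Fin N)) :
    SWord A a (mother A c r l) =ᵐ[mu A] fun w =>
      (((q : ℝ) ^ (-(1 / 2) : ℝ) : ℝ) : ℂ) ^ a.length *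
        ∑ j, (A r j : ℂ) * c r l j * (cylinder A (a ++ [r, j])).indicator (fun _ => (1 : ℂ)) w := by
  induction a with
  | nil =>
    refine Filter.Eventually.of_forall fun w => ?_
    simp [SWord, mother]
  | cons i a ih =>
    refine (h.S_ae_eq i ih).trans (Filter.Eventually.of_forall fun w => ?_)
    dsimp only
    by_cases hw : w ∈ cylinder A [i]
    · rw [indicator_of_mem hw, List.length_cons, pow_succ', mul_assoc]
      congr 3
      funext j
      congr 1
      rw [List.cons_append]
      by_cases hs : shift A w ∈ cylinder A (a ++ [r, j])
      · rw [indicator_of_mem hs, indicator_of_mem (mem_cylinder_cons.2 ⟨hw, hs⟩)]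
      · rw [indicator_of_notMem hs, indicator_of_notMem fun hc => hs (mem_cylinder_cons.1 hc).2]
    · rw [indicator_of_notMem hw, eq_comm, mul_eq_zero]
      right
      refine Finset.sum_eq_zero fun j _ => ?_
      rw [List.cons_append, indicator_of_notMem fun hc => hw (mem_cylinder_cons.1 hc).1, mul_zero]

end IsSelfSimilar

lemma mother_eq_zero_of_notMem (c : (r : Fin N) → Fin (outDegree A r - 1) → Fin N → ℂ) {r : Fin N}
    (l : Fin (outDegree A r - 1)) {w : Shift A} (hw : w ∉ cylinder A [r]) :
    mother A c r l w = 0 := by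
  refine Finset.sum_eq_zero fun j _ => ?_
  have hj : w ∉ cylinder A [r, j] := fun hc => hw (cylinder_append_subset [r] [j] hc)
  rw [indicator_of_notMem hj, mul_zero]

/-- The indicator in `S_i` confines supports pointwise, so the vanishing for non-admissible `ar` is
an equality of functions, not only of classes. -/
lemma SWord_eq_zero_of_notMem {b : List (Fin N)} {ψ : Shift A → ℂ}
    (hψ : ∀ w ∉ cylinder A b, ψ w = 0) (a : List (Fin N)) :
    ∀ w ∉ cylinder A (a ++ b), SWord A a ψ w = 0 := by
  induction a with
  | nil => exact hψ
  | cons i a ih =>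
    intro w hw
    change S A i (SWord A a ψ) w = 0
    by_cases hi : w ∈ cylinder A [i]
    · rw [S, indicator_of_mem hi, ih _ fun hc => hw (mem_cylinder_cons.2 ⟨hi, hc⟩), mul_zero]
    · rw [S, indicator_of_notMem hi]

/-- `S_a f^{ℓ,r}` vanishes if `ar` is not admissible. -/
theorem SWord_mother_eq_zero (c : (r : Fin N) → Fin (outDegree A r - 1) → Fin N → ℂ)
    (a : List (Fin N)) (r : Fin N) (l : Fin (outDegree A r - 1))
    (h : ¬ Admissible A (a ++ [r])) : SWord A a (mother A c r l) = 0 := by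
  funext w
  refine SWord_eq_zero_of_notMem (b := [r]) (fun w hw => mother_eq_zero_of_notMem c l hw) a w ?_
  rw [cylinder_eq_empty h]
  exact notMem_empty w

end CKWavelet

/-! ### The spaces `𝔖_k` and totality of the cylinder functions. -/

namespace CKWavelet

variable {N : ℕ} {A : Matrix (Fin N) (Fin N) ℕ}

lemma levelSpace_mono : Monotone (levelSpace A) := by
  refine monotone_nat_of_le_succ fun k f hf a ha hadm => ?_
  have hne : a ≠ [] := fun h => by simp [h] at ha
  have heq := List.dropLast_append_getLast hne
  obtain ⟨z, hz⟩ := hf a.dropLast (by simp [ha]) (hadm.prefix (List.dropLast_prefix a))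
  refine ⟨z, ?_⟩
  filter_upwards [hz] with w hw hwa
  rw [← heq] at hwa
  exact hw (cylinder_append_subset _ _ hwa)

/-- Two cylinders are either disjoint or nested. -/
lemma isPiSystem_cylinder : IsPiSystem (range (cylinder A)) := by
  have key : ∀ a b : List (Fin N), a.length ≤ b.length → (cylinder A a ∩ cylinder A b).Nonempty →
      cylinder A a ∩ cylinder A b = cylinder A b := by
    rintro a b hab ⟨w, ha, hb⟩
    refine inter_eq_right.2 fun v hv n hn => ?_
    rw [hv n (by omega), ← hb n (by omega), ha n hn]
  rintro _ ⟨a, rfl⟩ _ ⟨b, rfl⟩ hne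
  rcases le_total a.length b.length with h | h
  · exact ⟨b, (key a b h hne).symm⟩
  · rw [inter_comm] at hne ⊢
    exact ⟨a, (key b a h hne).symm⟩

lemma generateFrom_cylinder :
    (inferInstance : MeasurableSpace (Shift A)) = MeasurableSpace.generateFrom (range (cylinder A)) := by
  apply le_antisymm
  · have h : ∀ n, @Measurable _ _ (MeasurableSpace.generateFrom (range (cylinder A))) _
        (fun w : Shift A => w.1 n) := by
      intro n
      refine @measurable_to_countable' _ _ _ _ (_) _ fun j => ?_
      have : (fun w : Shift A => w.1 n) ⁻¹' {j} =
          ⋃ a ∈ {a : List (Fin N) | a.length = n}, cylinder A (a ++ [j]) := by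
        ext w
        simp only [mem_preimage, mem_singleton_iff, mem_iUnion, mem_ofPred_eq, exists_prop,
          mem_cylinder_append_singleton]
        constructor
        · intro hw
          exact ⟨letters n w, length_letters n w, mem_cylinder_letters n w, by rwa [length_letters]⟩
        · rintro ⟨a, rfl, -, hw⟩
          exact hw
      rw [this]
      exact MeasurableSet.biUnion (to_countable _) fun a _ =>
        MeasurableSpace.measurableSet_generateFrom ⟨_, rfl⟩
    have h2 : @Measurable _ _ (MeasurableSpace.generateFrom (range (cylinder A))) _
        (Subtype.val : Shift A → ℕ → Fin N) :=
      @measurable_pi_lambda _ _ _ (_) _ _ h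
    rintro _ ⟨F, hF, rfl⟩
    exact h2 hF
  · refine MeasurableSpace.generateFrom_le ?_
    rintro _ ⟨a, rfl⟩
    exact measurableSet_cylinder a

variable [IsFiniteMeasure (mu A)]

/-- The characteristic function of a cylinder, as an element of `L²(Λ_A, μ_A)`. -/
noncomputable def chi (A : Matrix (Fin N) (Fin N) ℕ) [IsFiniteMeasure (mu A)] (a : List (Fin N)) :
    Lp ℂ 2 (mu A) :=
  indicatorConstLp 2 (measurableSet_cylinder a) (measure_ne_top _ _) 1

lemma chi_coeFn (a : List (Fin N)) :
    chi A a =ᵐ[mu A] (cylinder A a).indicator fun _ => (1 : ℂ) :=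
  indicatorConstLp_coeFn

lemma inner_chi (a : List (Fin N)) (f : Lp ℂ 2 (mu A)) :
    inner ℂ (chi A a) f = ∫ w in cylinder A a, f w ∂(mu A) :=
  L2.inner_indicatorConstLp_one _ _ _

lemma inner_chi_chi (a b : List (Fin N)) :
    inner ℂ (chi A a) (chi A b) = (((mu A).real (cylinder A a ∩ cylinder A b) : ℝ) : ℂ) :=
  L2.inner_indicatorConstLp_one_indicatorConstLp_one _ _

lemma inner_chi_chi_self (a : List (Fin N)) :
    inner ℂ (chi A a) (chi A a) = (((mu A).real (cylinder A a) : ℝ) : ℂ) := by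
  rw [inner_chi_chi, inter_self]

lemma inner_chi_chi_of_ne {a b : List (Fin N)} (hl : a.length = b.length) (hne : a ≠ b) :
    inner ℂ (chi A a) (chi A b) = 0 := by
  rw [inner_chi_chi, (disjoint_cylinder hl hne).inter_eq, measureReal_empty, Complex.ofReal_zero]

lemma inner_chi_chi_append (a b : List (Fin N)) :
    inner ℂ (chi A a) (chi A (a ++ b)) = (((mu A).real (cylinder A (a ++ b)) : ℝ) : ℂ) := by
  rw [inner_chi_chi, inter_eq_right.2 (cylinder_append_subset a b)]

lemma chi_eq_zero {a : List (Fin N)} (h : ¬ Admissible A a) : chi A a = 0 := by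
  rw [← inner_self_eq_zero (𝕜 := ℂ), inner_chi_chi_self, cylinder_eq_empty h, measureReal_empty,
    Complex.ofReal_zero]

/-- The sum runs over all letters; those that cannot follow `a` contribute empty cylinders. -/
lemma chi_eq_sum (a : List (Fin N)) : chi A a = ∑ j, chi A (a ++ [j]) := by
  refine Lp.ext ?_
  have h : ∀ᵐ w ∂(mu A), ∀ j, chi A (a ++ [j]) w =
      (cylinder A (a ++ [j])).indicator (fun _ => (1 : ℂ)) w :=
    ae_all_iff.2 fun j => chi_coeFn _
  filter_upwards [chi_coeFn a, h, Lp.coeFn_finsetSum Finset.univ fun j => chi A (a ++ [j])]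
    with w h1 h2 h3
  rw [h3, h1, Finset.sum_apply, Finset.sum_congr rfl fun j _ => h2 j]
  by_cases hw : w ∈ cylinder A a
  · rw [indicator_of_mem hw, Finset.sum_eq_single (w.1 a.length)]
    · rw [indicator_of_mem (mem_cylinder_append_singleton.2 ⟨hw, rfl⟩)]
    · intro j _ hj
      rw [indicator_of_notMem fun hc => hj (mem_cylinder_append_singleton.1 hc).2.symm]
    · exact fun hc => absurd (Finset.mem_univ _) hc
  · rw [indicator_of_notMem hw, Finset.sum_eq_zero fun j _ => ?_]
    rw [indicator_of_notMem fun hc => hw (mem_cylinder_append_singleton.1 hc).1]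

lemma chi_mem_levelSpace (a : List (Fin N)) : chi A a ∈ levelSpace A a.length := by
  intro b hb _
  by_cases hab : a = b
  · subst hab
    refine ⟨1, ?_⟩
    filter_upwards [chi_coeFn a] with w hw hwa
    rw [hw, indicator_of_mem hwa]
  · refine ⟨0, ?_⟩
    filter_upwards [chi_coeFn a] with w hw hwb
    rw [hw, indicator_of_notMem fun hc =>
      (Set.disjoint_left.1 (disjoint_cylinder hb.symm hab)) hc hwb]

/-- `𝔖_k` is spanned by the characteristic functions of the cylinders of length `k`. -/
lemma levelSpace_eq_span (k : ℕ) : levelSpace A k =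
    Submodule.span ℂ (chi A '' {a | a.length = k ∧ Admissible A a}) := by
  classical
  apply le_antisymm
  · intro f hf
    have hex : ∀ a : List (Fin N), ∃ z : ℂ, a.length = k → Admissible A a →
        ∀ᵐ w ∂(mu A), w ∈ cylinder A a → f w = z := by
      intro a
      by_cases ha : a.length = k ∧ Admissible A a
      · obtain ⟨z, hz⟩ := hf a ha.1 ha.2
        exact ⟨z, fun _ _ => hz⟩
      · exact ⟨0, fun h1 h2 => absurd ⟨h1, h2⟩ ha⟩
    choose z hz using hex
    set T : Finset (List (Fin N)) :=
      (List.finite_length_eq (Fin N) k).toFinset.filter (Admissible A) with hT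
    have hmem : ∀ a, a ∈ T ↔ a.length = k ∧ Admissible A a := by
      intro a
      simp [hT]
    have hfsum : f = ∑ a ∈ T, z a • chi A a := by
      refine Lp.ext ?_
      have h1 : ∀ᵐ w ∂(mu A), ∀ a : List (Fin N), a.length = k → Admissible A a →
          w ∈ cylinder A a → f w = z a :=
        ae_all_iff.2 fun a => by
          by_cases ha : a.length = k ∧ Admissible A a
          · filter_upwards [hz a ha.1 ha.2] with w hw _ _ using hw
          · exact Filter.Eventually.of_forall fun w h1 h2 => absurd ⟨h1, h2⟩ ha
      have h2 : ∀ᵐ w ∂(mu A), ∀ a, (z a • chi A a : Lp ℂ 2 (mu A)) w =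
          z a * (cylinder A a).indicator (fun _ => (1 : ℂ)) w :=
        ae_all_iff.2 fun a => by
          filter_upwards [Lp.coeFn_smul (z a) (chi A a), chi_coeFn a] with w hw hw'
          rw [hw, Pi.smul_apply, hw', smul_eq_mul]
      filter_upwards [h1, h2, Lp.coeFn_finsetSum T fun a => z a • chi A a] with w h1 h2 h3
      rw [h3, Finset.sum_apply, Finset.sum_congr rfl fun a _ => h2 a,
        Finset.sum_eq_single (letters k w)]
      · have hw := mem_cylinder_letters k w
        rw [indicator_of_mem hw, mul_one]
        exact h1 _ (length_letters k w) (admissible_letters k w) hw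
      · intro b hb hne
        rw [indicator_of_notMem, mul_zero]
        intro hc
        rw [mem_cylinder_iff, ((hmem b).1 hb).1] at hc
        exact hne hc.symm
      · exact fun hc => absurd ((hmem _).2 ⟨length_letters k w, admissible_letters k w⟩) hc
    rw [hfsum]
    exact Submodule.sum_mem _ fun a ha => Submodule.smul_mem _ _
      (Submodule.subset_span ⟨a, (hmem a).1 ha, rfl⟩)
  · rw [Submodule.span_le]
    rintro _ ⟨a, ⟨rfl, _⟩, rfl⟩
    exact chi_mem_levelSpace a

/-- The characteristic functions of cylinders are total in `L²(Λ_A, μ_A)`. -/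
lemma eq_zero_of_inner_chi_eq_zero {f : Lp ℂ 2 (mu A)} (h : ∀ a, inner ℂ (chi A a) f = 0) :
    f = 0 := by
  have hint : Integrable f (mu A) := (Lp.memLp f).integrable one_le_two
  have h0 : ∀ E : Set (Shift A), MeasurableSet E → ∫ w in E, f w ∂(mu A) = 0 := by
    -- The sets over which `f` integrates to `0` are treated by the π-λ theorem; for complements,
    -- the whole space is the cylinder of the empty word.
    refine MeasurableSpace.induction_on_inter generateFrom_cylinder isPiSystem_cylinder ?_ ?_ ?_ ?_
    · simp
    · rintro _ ⟨a, rfl⟩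
      rw [← inner_chi, h]
    · intro E hE hE0
      rw [setIntegral_compl hE hint, hE0, sub_zero, ← setIntegral_univ, ← cylinder_nil,
        ← inner_chi, h]
    · intro F hd hF hF0
      rw [integral_iUnion hF hd hint.integrableOn]
      simp [hF0]
  rw [Lp.eq_zero_iff_ae_eq_zero]
  exact hint.ae_eq_zero_of_forall_setIntegral_eq_zero fun E hE _ => h0 E hE

end CKWavelet

/-! ### Inner products of combinations of cylinder functions. -/

namespace CKWavelet

variable {N : ℕ} {A : Matrix (Fin N) (Fin N) ℕ}

lemma admissible_append_pair {a : List (Fin N)} {r j : Fin N} :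
    Admissible A (a ++ [r, j]) ↔ Admissible A (a ++ [r]) ∧ A r j = 1 := by
  simp only [Admissible, List.isChain_append, List.isChain_cons_cons, List.isChain_singleton,
    List.head?_cons, and_true, true_and]
  tauto

lemma IsSelfSimilar.real_cylinder_append_pair {q : NNReal} (h : IsSelfSimilar A q) {a : List (Fin N)} {r j : Fin N}
    (ha : Admissible A (a ++ [r])) (hj : A r j = 1) :
    (mu A).real (cylinder A (a ++ [r, j])) =
      (q : ℝ) ^ a.length * (mu A).real (cylinder A ([] ++ [r, j])) := by
  rw [measureReal_def, h.mu_cylinder_append (List.cons_ne_nil _ _) a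
    (admissible_append_pair.2 ⟨ha, hj⟩), ENNReal.toReal_mul, ENNReal.toReal_pow]
  rfl

/-- Reduces sums at `a` to the empty word. It is used with `z` the coefficients of `f^{ℓ,r}`, for
the mean, and with the products of two such families, for orthonormality. -/
lemma IsSelfSimilar.sum_motherCoeff {q : NNReal} (h : IsSelfSimilar A q) {a : List (Fin N)} {r : Fin N}
    (ha : Admissible A (a ++ [r])) (z : Fin N → ℂ) (hz : ∀ j, A r j ≠ 1 → z j = 0) :
    ∑ j, z j * (((mu A).real (cylinder A (a ++ [r, j])) : ℝ) : ℂ) =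
      (q : ℂ) ^ a.length *
        ∑ j, z j * (((mu A).real (cylinder A ([] ++ [r, j])) : ℝ) : ℂ) := by
  rw [Finset.mul_sum]
  refine Finset.sum_congr rfl fun j _ => ?_
  by_cases hj : A r j = 1
  · rw [h.real_cylinder_append_pair ha hj]
    push_cast
    ring
  · rw [hz j hj, zero_mul, zero_mul, mul_zero]

/-- The normalization `q ^ (-k/2)` produced by `S_a` exactly compensates the factor `q ^ k` of the
measure. -/
lemma conj_rpow_mul {q : NNReal} (hq : 0 < q) (k : ℕ) :
    conj ((((q : ℝ) ^ (-(1 / 2) : ℝ) : ℝ) : ℂ) ^ k) *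
      ((((q : ℝ) ^ (-(1 / 2) : ℝ) : ℝ) : ℂ) ^ k * (q : ℂ) ^ k) = 1 := by
  have hq : (0 : ℝ) < q := hq
  have h1 : (q : ℝ) ^ (-(1 / 2) : ℝ) * ((q : ℝ) ^ (-(1 / 2) : ℝ) * q) = 1 := by
    rw [← mul_assoc, ← Real.rpow_add hq, show (-(1 / 2) + -(1 / 2) : ℝ) = -1 by norm_num,
      Real.rpow_neg_one, inv_mul_cancel₀ hq.ne']
  rw [map_pow, Complex.conj_ofReal, ← mul_pow, ← mul_pow]
  rw [show ((((q : ℝ) ^ (-(1 / 2) : ℝ) : ℝ) : ℂ) * ((((q : ℝ) ^ (-(1 / 2) : ℝ) : ℝ) : ℂ) *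
    (q : ℂ))) = 1 by exact_mod_cast h1, one_pow]

/-- The coefficients of `f^{ℓ,r}` with respect to the functions `χ_{R_{rj}}`. -/
noncomputable def motherCoeff (A : Matrix (Fin N) (Fin N) ℕ)
    (c : (r : Fin N) → Fin (outDegree A r - 1) → Fin N → ℂ) (r : Fin N)
    (l : Fin (outDegree A r - 1)) (j : Fin N) : ℂ :=
  (A r j : ℂ) * c r l j

lemma motherCoeff_eq_zero {c : (r : Fin N) → Fin (outDegree A r - 1) → Fin N → ℂ}
    (h01 : ∀ i j, A i j = 0 ∨ A i j = 1) (r : Fin N)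
    (l : Fin (outDegree A r - 1)) (j : Fin N) (hj : A r j ≠ 1) : motherCoeff A c r l j = 0 := by
  rw [motherCoeff, (h01 r j).resolve_right hj, Nat.cast_zero, zero_mul]

variable [IsFiniteMeasure (mu A)]

/-- `∑_j z_j χ_{arj}`, as an element of `L²(Λ_A, μ_A)`. -/
noncomputable def comb (A : Matrix (Fin N) (Fin N) ℕ) [IsFiniteMeasure (mu A)] (a : List (Fin N))
    (r : Fin N) (z : Fin N → ℂ) : Lp ℂ 2 (mu A) :=
  ∑ j, z j • chi A (a ++ [r, j])

lemma comb_coeFn (a : List (Fin N)) (r : Fin N) (z : Fin N → ℂ) :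
    comb A a r z =ᵐ[mu A] fun w =>
      ∑ j, z j * (cylinder A (a ++ [r, j])).indicator (fun _ => (1 : ℂ)) w := by
  have h : ∀ᵐ w ∂(mu A), ∀ j, (z j • chi A (a ++ [r, j]) : Lp ℂ 2 (mu A)) w =
      z j * (cylinder A (a ++ [r, j])).indicator (fun _ => (1 : ℂ)) w :=
    ae_all_iff.2 fun j => by
      filter_upwards [Lp.coeFn_smul (z j) (chi A (a ++ [r, j])), chi_coeFn (a ++ [r, j])]
        with w hw hw'
      rw [hw, Pi.smul_apply, hw', smul_eq_mul]
  filter_upwards [h, Lp.coeFn_finsetSum Finset.univ fun j => z j • chi A (a ++ [r, j])]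
    with w h1 h2
  rw [comb, h2, Finset.sum_apply]
  exact Finset.sum_congr rfl fun j _ => h1 j

lemma inner_comb_comb (a : List (Fin N)) (r : Fin N) (z z' : Fin N → ℂ) :
    inner ℂ (comb A a r z) (comb A a r z') =
      ∑ j, conj (z j) * z' j * (((mu A).real (cylinder A (a ++ [r, j])) : ℝ) : ℂ) := by
  rw [comb, comb, sum_inner]
  refine Finset.sum_congr rfl fun j _ => ?_
  rw [inner_sum, Finset.sum_eq_single j]
  · rw [inner_smul_left, inner_smul_right, inner_chi_chi_self, mul_assoc]
  · intro j' _ hj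
    rw [inner_smul_left, inner_smul_right, inner_chi_chi_of_ne (by simp) (by simpa using hj.symm),
      mul_zero, mul_zero]
  · exact fun hc => absurd (Finset.mem_univ _) hc

lemma inner_comb_comb_of_ne {a a' : List (Fin N)} {r r' : Fin N} (hl : a.length = a'.length)
    (hne : ¬ (a = a' ∧ r = r')) (z z' : Fin N → ℂ) :
    inner ℂ (comb A a r z) (comb A a' r' z') = 0 := by
  rw [comb, comb, sum_inner]
  refine Finset.sum_eq_zero fun j _ => ?_
  rw [inner_sum]
  refine Finset.sum_eq_zero fun j' _ => ?_
  rw [inner_smul_left, inner_smul_right, inner_chi_chi_of_ne (by simp [hl]), mul_zero, mul_zero]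
  intro hc
  have := List.append_inj hc hl
  simp only [List.cons.injEq] at this
  exact hne ⟨this.1, this.2.1⟩

lemma inner_chi_comb (a : List (Fin N)) (r : Fin N) (z : Fin N → ℂ) :
    inner ℂ (chi A (a ++ [r])) (comb A a r z) =
      ∑ j, z j * (((mu A).real (cylinder A (a ++ [r, j])) : ℝ) : ℂ) := by
  rw [comb, inner_sum]
  refine Finset.sum_congr rfl fun j _ => ?_
  have := inner_chi_chi_append (A := A) (a ++ [r]) [j]
  rw [List.append_assoc] at this
  rw [inner_smul_right]
  exact congrArg _ this

lemma inner_chi_comb_of_ne {a b : List (Fin N)} {r : Fin N} (hl : b.length = a.length + 1)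
    (hne : b ≠ a ++ [r]) (z : Fin N → ℂ) : inner ℂ (chi A b) (comb A a r z) = 0 := by
  rw [comb, inner_sum]
  refine Finset.sum_eq_zero fun j _ => ?_
  have hd : Disjoint (cylinder A b) (cylinder A (a ++ [r, j])) := by
    refine (disjoint_cylinder (b := a ++ [r]) (by simp [hl]) hne).mono_right ?_
    have := cylinder_append_subset (A := A) (a ++ [r]) [j]
    rwa [List.append_assoc] at this
  rw [inner_smul_right, inner_chi_chi, hd.inter_eq, measureReal_empty, Complex.ofReal_zero,
    mul_zero]

variable {c : (r : Fin N) → Fin (outDegree A r - 1) → Fin N → ℂ}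

lemma comb_nil_ae_eq_mother (r : Fin N) (l : Fin (outDegree A r - 1)) :
    comb A [] r (motherCoeff A c r l) =ᵐ[mu A] mother A c r l :=
  comb_coeFn [] r _

lemma inner_comb_nil (hc : IsMotherFamily A c) (r : Fin N) (l l' : Fin (outDegree A r - 1)) :
    inner ℂ (comb A [] r (motherCoeff A c r l)) (comb A [] r (motherCoeff A c r l')) =
      if l = l' then 1 else 0 := by
  -- Since `f^{ℓ,r}` vanishes off `R_r`, the integral over `R_r` is the full inner product.
  rw [← hc.orthonormal r l l', L2.inner_def, setIntegral_eq_integral_of_forall_compl_eq_zero]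
  · refine integral_congr_ae ?_
    filter_upwards [comb_nil_ae_eq_mother (c := c) r l, comb_nil_ae_eq_mother (c := c) r l']
      with w h1 h2
    rw [h1, h2, RCLike.inner_apply, mul_comm]
  · intro w hw
    rw [mother_eq_zero_of_notMem c l' hw, mul_zero]

lemma inner_chi_comb_nil (hc : IsMotherFamily A c) (r : Fin N) (l : Fin (outDegree A r - 1)) :
    inner ℂ (chi A [r]) (comb A [] r (motherCoeff A c r l)) = 0 := by
  rw [inner_chi, ← hc.mean_zero r l]
  exact integral_congr_ae (ae_restrict_of_ae (comb_nil_ae_eq_mother r l))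

/-- The wavelet `S_a f^{ℓ,r}` as an element of `L²(Λ_A, μ_A)`. -/
noncomputable def waveletLp (A : Matrix (Fin N) (Fin N) ℕ) [IsFiniteMeasure (mu A)] (q : NNReal)
    (c : (r : Fin N) → Fin (outDegree A r - 1) → Fin N → ℂ) (k : ℕ) (i : WaveletIndex A k) :
    Lp ℂ 2 (mu A) :=
  (((q : ℝ) ^ (-(1 / 2) : ℝ) : ℝ) : ℂ) ^ k •
    comb A i.1.1.1 i.1.1.2 (motherCoeff A c i.1.1.2 i.2)

/-- The normalized characteristic function of `R_i` as an element of `L²(Λ_A, μ_A)`. -/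
noncomputable def scalingLp (A : Matrix (Fin N) (Fin N) ℕ) [IsFiniteMeasure (mu A)] (i : Fin N) :
    Lp ℂ 2 (mu A) :=
  (((mu A (cylinder A [i])).toReal ^ (-(1 / 2) : ℝ) : ℝ) : ℂ) • chi A [i]

lemma scalingLp_coeFn (i : Fin N) : scalingLp A i =ᵐ[mu A] scaling A i := by
  filter_upwards [Lp.coeFn_smul
    (((mu A (cylinder A [i])).toReal ^ (-(1 / 2) : ℝ) : ℝ) : ℂ) (chi A [i]), chi_coeFn [i]]
    with w h1 h2
  rw [scalingLp, h1, Pi.smul_apply, h2, scaling]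
  by_cases hw : w ∈ cylinder A [i]
  · rw [indicator_of_mem hw, indicator_of_mem hw, smul_eq_mul, mul_one]
  · rw [indicator_of_notMem hw, indicator_of_notMem hw, smul_zero]

namespace IsSelfSimilar

variable {q : NNReal}

lemma waveletLp_coeFn (h : IsSelfSimilar A q) (k : ℕ) (i : WaveletIndex A k) :
    waveletLp A q c k i =ᵐ[mu A] wavelet A c k i := by
  refine Filter.EventuallyEq.trans ?_ (h.SWord_mother_ae_eq c i.1.1.2 i.2 i.1.1.1).symm
  filter_upwards [Lp.coeFn_smul ((((q : ℝ) ^ (-(1 / 2) : ℝ) : ℝ) : ℂ) ^ k)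
    (comb A i.1.1.1 i.1.1.2 (motherCoeff A c i.1.1.2 i.2)), comb_coeFn (A := A) i.1.1.1 i.1.1.2
      (motherCoeff A c i.1.1.2 i.2)] with w h1 h2
  rw [waveletLp, h1, Pi.smul_apply, h2, smul_eq_mul, i.1.2.1]
  rfl

end IsSelfSimilar
end CKWavelet

/-! ### Orthonormality and completeness of the wavelets. -/

namespace CKWavelet

variable {N : ℕ} {A : Matrix (Fin N) (Fin N) ℕ} [IsFiniteMeasure (mu A)]
variable {c : (r : Fin N) → Fin (outDegree A r - 1) → Fin N → ℂ} {q : NNReal}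

lemma finiteDimensional_levelSpace (k : ℕ) : FiniteDimensional ℂ (levelSpace A k) := by
  rw [levelSpace_eq_span]
  refine FiniteDimensional.span_of_finite ℂ (Finite.image _ ?_)
  exact (List.finite_length_eq (Fin N) k).subset fun a ha => ha.1

lemma comb_mem_levelSpace (a : List (Fin N)) (r : Fin N) (z : Fin N → ℂ) :
    comb A a r z ∈ levelSpace A (a.length + 2) := by
  refine Submodule.sum_mem _ fun j _ => Submodule.smul_mem _ _ ?_
  have := chi_mem_levelSpace (A := A) (a ++ [r, j])
  simpa using this

lemma waveletLp_mem_levelSpace (k : ℕ) (i : WaveletIndex A k) :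
    waveletLp A q c k i ∈ levelSpace A (k + 2) := by
  have := comb_mem_levelSpace (A := A) i.1.1.1 i.1.1.2 (motherCoeff A c i.1.1.2 i.2)
  rw [i.1.2.1] at this
  exact Submodule.smul_mem _ _ this

lemma scalingLp_mem_levelSpace (i : Fin N) : scalingLp A i ∈ levelSpace A 1 :=
  Submodule.smul_mem _ _ (chi_mem_levelSpace [i])

namespace IsSelfSimilar

lemma inner_chi_comb_motherCoeff (h : IsSelfSimilar A q) (h01 : ∀ i j, A i j = 0 ∨ A i j = 1)
    (hc : IsMotherFamily A c) {a : List (Fin N)} {r : Fin N} (ha : Admissible A (a ++ [r]))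
    (l : Fin (outDegree A r - 1)) :
    inner ℂ (chi A (a ++ [r])) (comb A a r (motherCoeff A c r l)) = 0 := by
  rw [inner_chi_comb, h.sum_motherCoeff ha _ (motherCoeff_eq_zero h01 r l)]
  have h0 := inner_chi_comb (A := A) [] r (motherCoeff A c r l)
  rw [List.nil_append, inner_chi_comb_nil hc] at h0
  rw [← h0, mul_zero]

lemma inner_comb_motherCoeff (h : IsSelfSimilar A q) (h01 : ∀ i j, A i j = 0 ∨ A i j = 1)
    (hc : IsMotherFamily A c) {a : List (Fin N)} {r : Fin N} (ha : Admissible A (a ++ [r]))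
    (l l' : Fin (outDegree A r - 1)) :
    inner ℂ (comb A a r (motherCoeff A c r l)) (comb A a r (motherCoeff A c r l')) =
      if l = l' then (q : ℂ) ^ a.length else 0 := by
  rw [inner_comb_comb, h.sum_motherCoeff ha
    (fun j => conj (motherCoeff A c r l j) * motherCoeff A c r l' j)
    (fun j hj => by rw [motherCoeff_eq_zero h01 r l' j hj, mul_zero]),
    ← inner_comb_comb, inner_comb_nil hc]
  split_ifs <;> simp

lemma orthonormal_waveletLp (h : IsSelfSimilar A q) (h01 : ∀ i j, A i j = 0 ∨ A i j = 1)
    (hc : IsMotherFamily A c) (k : ℕ) : Orthonormal ℂ (waveletLp A q c k) := by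
  classical
  rw [orthonormal_iff_ite]
  rintro ⟨⟨⟨a, r⟩, hl, ha⟩, l⟩ ⟨⟨⟨a', r'⟩, hl', ha'⟩, l'⟩
  dsimp only at hl ha hl' ha' l l'
  rw [waveletLp, waveletLp, inner_smul_left, inner_smul_right]
  dsimp only
  by_cases hp : a = a' ∧ r = r'
  · obtain ⟨rfl, rfl⟩ := hp
    rw [h.inner_comb_motherCoeff h01 hc ha]
    by_cases hll : l = l'
    · subst hll
      rw [if_pos rfl, if_pos rfl, hl, conj_rpow_mul h.pos]
    · rw [if_neg hll, mul_zero, mul_zero, if_neg]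
      intro he
      exact hll (eq_of_heq (Sigma.mk.inj he).2)
  · rw [inner_comb_comb_of_ne (hl.trans hl'.symm) hp, mul_zero, mul_zero, if_neg]
    intro he
    have h1 := congrArg Subtype.val (Sigma.mk.inj he).1
    exact hp ⟨congrArg Prod.fst h1, congrArg Prod.snd h1⟩

/-- It suffices to test against `χ_b` with `b` of length `k + 1`: for `b ≠ ar` the supports are
disjoint, and for `b = ar` this is the mean zero condition. -/
lemma waveletLp_mem_orthogonal (h : IsSelfSimilar A q) (h01 : ∀ i j, A i j = 0 ∨ A i j = 1)
    (hc : IsMotherFamily A c) (k : ℕ) (i : WaveletIndex A k) :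
    waveletLp A q c k i ∈ (levelSpace A (k + 1))ᗮ := by
  rw [Submodule.mem_orthogonal]
  intro u hu
  rw [levelSpace_eq_span] at hu
  induction hu using Submodule.span_induction with
  | mem x hx =>
    obtain ⟨b, ⟨hb, -⟩, rfl⟩ := hx
    rw [waveletLp, inner_smul_right, mul_eq_zero]
    right
    by_cases hbe : b = i.1.1.1 ++ [i.1.1.2]
    · rw [hbe, h.inner_chi_comb_motherCoeff h01 hc i.1.2.2]
    · exact inner_chi_comb_of_ne (by rw [hb, i.1.2.1]) hbe _
  | zero => exact inner_zero_left _
  | add x y _ _ hx hy => rw [inner_add_left, hx, hy, add_zero]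
  | smul t x _ hx => rw [inner_smul_left, hx, mul_zero]

/-- The functions `χ_{arj}` are combinations of `χ_{ar}` and the wavelets `S_a f^{ℓ,r}`: there are
as many of the one as of the other. -/
lemma chi_mem_span_sup (h : IsSelfSimilar A q) (h01 : ∀ i j, A i j = 0 ∨ A i j = 1)
    (hdiag : ∀ i, A i i = 1) (hc : IsMotherFamily A c) {a : List (Fin N)} {r j : Fin N}
    (ha : Admissible A (a ++ [r])) :
    chi A (a ++ [r, j]) ∈ Submodule.span ℂ (range (waveletLp A q c a.length)) ⊔
      levelSpace A (a.length + 1) := by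
  classical
  -- `none` stands for `χ_{ar}`, the remaining indices for the `d_r - 1` wavelets at `ar`.
  set v : Option (Fin (outDegree A r - 1)) → Lp ℂ 2 (mu A) := fun o =>
    o.elim (chi A (a ++ [r])) fun l => waveletLp A q c a.length ⟨⟨(a, r), rfl, ha⟩, l⟩ with hv
  set U : Submodule ℂ (Lp ℂ 2 (mu A)) :=
    Submodule.span ℂ (range fun j : {j // A r j = 1} => chi A (a ++ [r, j.1])) with hU
  have hchi : ∀ j, chi A (a ++ [r, j]) ∈ U := by
    intro j
    by_cases hj : A r j = 1
    · exact Submodule.subset_span ⟨⟨j, hj⟩, rfl⟩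
    · rw [chi_eq_zero fun hadm => hj (admissible_append_pair.1 hadm).2]
      exact U.zero_mem
  have hon := h.orthonormal_waveletLp h01 hc a.length
  have hlin : LinearIndependent ℂ v := by
    have hsome : ∀ l, inner ℂ (v none) (v (some l)) = 0 := by
      intro l
      change inner ℂ (chi A (a ++ [r])) (_ • comb A a r _) = 0
      rw [inner_smul_right, h.inner_chi_comb_motherCoeff h01 hc ha, mul_zero]
    refine linearIndependent_of_ne_zero_of_inner_eq_zero (𝕜 := ℂ) ?_ ?_
    · rintro (_ | l)
      · intro h0
        have h1 := inner_chi_chi_self (A := A) (a ++ [r])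
        change chi A (a ++ [r]) = 0 at h0
        rw [h0, inner_zero_left, eq_comm, Complex.ofReal_eq_zero, measureReal_eq_zero_iff] at h1
        exact h.mu_cylinder_ne_zero ha h1
      · exact hon.ne_zero _
    · rintro (_ | l) (_ | l') hne
      · exact absurd rfl hne
      · exact hsome l'
      · exact inner_eq_zero_symm.1 (hsome l)
      · refine hon.2 fun he => hne ?_
        rw [eq_of_heq (Sigma.mk.inj he).2]
  have hle : Submodule.span ℂ (range v) ≤ U := by
    rw [Submodule.span_le]
    rintro _ ⟨_ | l, rfl⟩
    · change chi A (a ++ [r]) ∈ U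
      rw [chi_eq_sum]
      refine Submodule.sum_mem _ fun j _ => ?_
      rw [List.append_assoc]
      exact hchi j
    · exact Submodule.smul_mem _ _
        (Submodule.sum_mem _ fun j _ => Submodule.smul_mem _ _ (hchi j))
  have hdeg : Fintype.card {j // A r j = 1} = outDegree A r := by
    rw [outDegree, Fintype.card_subtype]
  -- The diagonal entry gives `d_r ≥ 1`, so the truncated `d_r - 1` increased by one is `d_r`, and
  -- the dimensions agree.
  have hdeg0 : 0 < outDegree A r := by
    rw [outDegree, Finset.card_pos]
    exact ⟨r, by simp [hdiag]⟩
  have hfin : FiniteDimensional ℂ U := FiniteDimensional.span_of_finite ℂ (finite_range _)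
  have heq : Submodule.span ℂ (range v) = U := by
    refine Submodule.eq_of_le_of_finrank_le hle ?_
    rw [finrank_span_eq_card hlin, Fintype.card_option, Fintype.card_fin]
    refine (finrank_range_le_card (R := ℂ) _).trans ?_
    omega
  have hmem := hchi j
  rw [← heq] at hmem
  refine Submodule.span_le.2 ?_ hmem
  rintro _ ⟨_ | l, rfl⟩
  · refine Submodule.mem_sup_right ?_
    have := chi_mem_levelSpace (A := A) (a ++ [r])
    rwa [List.length_append] at this
  · exact Submodule.mem_sup_left (Submodule.subset_span ⟨_, rfl⟩)

lemma levelSpace_le_sup (h : IsSelfSimilar A q) (h01 : ∀ i j, A i j = 0 ∨ A i j = 1)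
    (hdiag : ∀ i, A i i = 1) (hc : IsMotherFamily A c) (k : ℕ) :
    levelSpace A (k + 2) ≤
      Submodule.span ℂ (range (waveletLp A q c k)) ⊔ levelSpace A (k + 1) := by
  rw [levelSpace_eq_span (k + 2), Submodule.span_le]
  rintro _ ⟨b, ⟨hb, hadm⟩, rfl⟩
  obtain ⟨a, r, j, rfl⟩ : ∃ a r j, b = a ++ [r, j] := by
    have h1 : b ≠ [] := fun h => by simp [h] at hb
    have h2 : b.dropLast ≠ [] := fun h => by
      have := congrArg List.length h
      rw [List.length_dropLast, hb] at this
      simp at this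
    refine ⟨b.dropLast.dropLast, b.dropLast.getLast h2, b.getLast h1, ?_⟩
    conv_lhs => rw [← List.dropLast_append_getLast h1, ← List.dropLast_append_getLast h2]
    simp
  have hk : a.length = k := by simpa using hb
  subst hk
  rw [admissible_append_pair] at hadm
  exact h.chi_mem_span_sup h01 hdiag hc hadm.1

lemma span_waveletLp (h : IsSelfSimilar A q) (h01 : ∀ i j, A i j = 0 ∨ A i j = 1)
    (hdiag : ∀ i, A i i = 1) (hc : IsMotherFamily A c) (k : ℕ) :
    Submodule.span ℂ (range (waveletLp A q c k)) = levelDiff A (k + 2) (k + 1) := by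
  have hle : Submodule.span ℂ (range (waveletLp A q c k)) ≤ levelDiff A (k + 2) (k + 1) := by
    rw [Submodule.span_le]
    rintro _ ⟨i, rfl⟩
    exact ⟨waveletLp_mem_levelSpace k i, h.waveletLp_mem_orthogonal h01 hc k i⟩
  refine le_antisymm hle ?_
  rintro x ⟨hx, hx'⟩
  obtain ⟨s, hs, t, ht, rfl⟩ := Submodule.mem_sup.1 (h.levelSpace_le_sup h01 hdiag hc k hx)
  -- The component `t` lies in `𝔖_{k+1}` and, as a difference of two vectors orthogonal to that
  -- space, also in its complement; so it vanishes.
  have ht' : t ∈ (levelSpace A (k + 1))ᗮ := by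
    have := Submodule.sub_mem _ hx' (hle hs).2
    rwa [add_sub_cancel_left] at this
  have ht0 : t = 0 := by
    have := Submodule.inner_right_of_mem_orthogonal ht ht'
    exact inner_self_eq_zero.1 this
  rwa [ht0, add_zero]

theorem isOrthonormalBasisOf_levelDiff (h : IsSelfSimilar A q)
    (h01 : ∀ i j, A i j = 0 ∨ A i j = 1) (hdiag : ∀ i, A i i = 1) (hc : IsMotherFamily A c)
    (k : ℕ) : IsOrthonormalBasisOf (waveletLp A q c k) (levelDiff A (k + 2) (k + 1)) := by
  refine ⟨h.orthonormal_waveletLp h01 hc k, ?_⟩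
  rw [h.span_waveletLp h01 hdiag hc k]
  have := finiteDimensional_levelSpace (A := A) (k + 2)
  have : FiniteDimensional ℂ (levelDiff A (k + 2) (k + 1)) :=
    Submodule.finiteDimensional_of_le inf_le_left
  exact (Submodule.closed_of_finiteDimensional _).submodule_topologicalClosure_eq

lemma orthonormal_sigma_waveletLp (h : IsSelfSimilar A q) (h01 : ∀ i j, A i j = 0 ∨ A i j = 1)
    (hc : IsMotherFamily A c) :
    Orthonormal ℂ fun i : Σ k : ℕ, WaveletIndex A k => waveletLp A q c i.1 i.2 := by
  refine ⟨fun i => (h.orthonormal_waveletLp h01 hc i.1).1 i.2, ?_⟩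
  -- For `k < k'`, the wavelets at scale `k` lie in `𝔖_{k+2} ⊆ 𝔖_{k'+1}`, to which those at scale
  -- `k'` are orthogonal.
  have hlt : ∀ k k' (i : WaveletIndex A k) (i' : WaveletIndex A k'), k < k' →
      inner ℂ (waveletLp A q c k i) (waveletLp A q c k' i') = 0 := fun k k' i i' hk =>
    Submodule.inner_right_of_mem_orthogonal
      (levelSpace_mono (by omega : k + 2 ≤ k' + 1) (waveletLp_mem_levelSpace k i))
      (h.waveletLp_mem_orthogonal h01 hc k' i')
  rintro ⟨k, i⟩ ⟨k', i'⟩ hne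
  rcases lt_trichotomy k k' with hk | rfl | hk
  · exact hlt k k' i i' hk
  · exact (h.orthonormal_waveletLp h01 hc k).2 fun he => hne (congrArg (Sigma.mk k) he)
  · exact inner_eq_zero_symm.1 (hlt k' k i' i hk)

lemma levelSpace_le_sup_sigma (h : IsSelfSimilar A q) (h01 : ∀ i j, A i j = 0 ∨ A i j = 1)
    (hdiag : ∀ i, A i i = 1) (hc : IsMotherFamily A c) (k : ℕ) :
    levelSpace A (k + 1) ≤ Submodule.span ℂ
      (range fun i : Σ k : ℕ, WaveletIndex A k => waveletLp A q c i.1 i.2) ⊔ levelSpace A 1 := by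
  induction k with
  | zero => exact le_sup_right
  | succ k ih =>
    refine (h.levelSpace_le_sup h01 hdiag hc k).trans (sup_le ?_ ih)
    refine le_sup_of_le_left (Submodule.span_mono ?_)
    rintro _ ⟨i, rfl⟩
    exact ⟨⟨k, i⟩, rfl⟩

/-- Descending through the scales, every cylinder function lies in the span of the wavelets and
`𝔖_1`, and these functions are total. -/
lemma orthogonal_sup_eq_bot (h : IsSelfSimilar A q) (h01 : ∀ i j, A i j = 0 ∨ A i j = 1)
    (hdiag : ∀ i, A i i = 1) (hc : IsMotherFamily A c) :
    (Submodule.span ℂ (range fun i : Σ k : ℕ, WaveletIndex A k => waveletLp A q c i.1 i.2) ⊔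
      levelSpace A 1)ᗮ = ⊥ := by
  rw [Submodule.eq_bot_iff]
  intro x hx
  refine eq_zero_of_inner_chi_eq_zero fun a => Submodule.inner_right_of_mem_orthogonal ?_ hx
  exact h.levelSpace_le_sup_sigma h01 hdiag hc a.length
    (levelSpace_mono (Nat.le_succ _) (chi_mem_levelSpace a))

theorem isOrthonormalBasisOf_orthogonal (h : IsSelfSimilar A q)
    (h01 : ∀ i j, A i j = 0 ∨ A i j = 1) (hdiag : ∀ i, A i i = 1) (hc : IsMotherFamily A c) :
    IsOrthonormalBasisOf (fun i : Σ k : ℕ, WaveletIndex A k => waveletLp A q c i.1 i.2)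
      (levelSpace A 1)ᗮ := by
  refine ⟨h.orthonormal_sigma_waveletLp h01 hc, ?_⟩
  set M := Submodule.span ℂ
    (range fun i : Σ k : ℕ, WaveletIndex A k => waveletLp A q c i.1 i.2) with hM
  have hle : M.topologicalClosure ≤ (levelSpace A 1)ᗮ := by
    refine Submodule.topologicalClosure_minimal _ ?_ (Submodule.isClosed_orthogonal _)
    rw [hM, Submodule.span_le]
    rintro _ ⟨i, rfl⟩
    exact Submodule.orthogonal_le (levelSpace_mono (by omega))
      (h.waveletLp_mem_orthogonal h01 hc i.1 i.2)
  have hcomp : CompleteSpace M.topologicalClosure :=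
    M.isClosed_topologicalClosure.completeSpace_coe
  -- With `K` the closure of `M`, `𝔖_1ᗮ` is the sum of `K` and `Kᗮ ⊓ 𝔖_1ᗮ`. The latter is `(M ⊔
  -- 𝔖_1)ᗮ = ⊥`.
  have hsup := Submodule.sup_orthogonal_inf_of_hasOrthogonalProjection hle
  rw [Submodule.orthogonal_closure, Submodule.inf_orthogonal, hM,
    h.orthogonal_sup_eq_bot h01 hdiag hc, sup_bot_eq] at hsup
  exact hsup

lemma orthonormal_scalingLp (h : IsSelfSimilar A q) : Orthonormal ℂ (scalingLp A) := by
  classical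
  rw [orthonormal_iff_ite]
  intro i j
  rw [scalingLp, scalingLp, inner_smul_left, inner_smul_right]
  by_cases hij : i = j
  · subst hij
    have hpos : 0 < (mu A (cylinder A [i])).toReal :=
      ENNReal.toReal_pos (h.mu_ne_zero i) (measure_ne_top _ _)
    rw [if_pos rfl, inner_chi_chi_self, Complex.conj_ofReal, measureReal_def, ← Complex.ofReal_mul,
      ← Complex.ofReal_mul, ← mul_assoc, ← Real.rpow_add hpos,
      show (-(1 / 2) + -(1 / 2) : ℝ) = -1 by norm_num, Real.rpow_neg_one,
      inv_mul_cancel₀ hpos.ne', Complex.ofReal_one]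
  · rw [if_neg hij, inner_chi_chi_of_ne (a := [i]) (b := [j]) rfl (by simpa using hij), mul_zero,
      mul_zero]

lemma span_scalingLp (h : IsSelfSimilar A q) :
    Submodule.span ℂ (range (scalingLp A)) = levelSpace A 1 := by
  apply le_antisymm
  · rw [Submodule.span_le]
    rintro _ ⟨i, rfl⟩
    exact scalingLp_mem_levelSpace i
  · rw [levelSpace_eq_span, Submodule.span_le]
    rintro _ ⟨a, ⟨ha, -⟩, rfl⟩
    obtain ⟨i, rfl⟩ := List.length_eq_one_iff.1 ha
    have hpos : 0 < (mu A (cylinder A [i])).toReal :=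
      ENNReal.toReal_pos (h.mu_ne_zero i) (measure_ne_top _ _)
    have hne : ((((mu A (cylinder A [i])).toReal ^ (-(1 / 2) : ℝ) : ℝ)) : ℂ) ≠ 0 :=
      Complex.ofReal_ne_zero.2 (Real.rpow_pos_of_pos hpos _).ne'
    have hchi : chi A [i] =
        ((((mu A (cylinder A [i])).toReal ^ (-(1 / 2) : ℝ) : ℝ)) : ℂ)⁻¹ • scalingLp A i := by
      rw [scalingLp, smul_smul, inv_mul_cancel₀ hne, one_smul]
    rw [SetLike.mem_coe, hchi]
    exact Submodule.smul_mem _ _ (Submodule.subset_span ⟨i, rfl⟩)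

theorem isOrthonormalBasisOf_top (h : IsSelfSimilar A q)
    (h01 : ∀ i j, A i j = 0 ∨ A i j = 1) (hdiag : ∀ i, A i i = 1) (hc : IsMotherFamily A c) :
    IsOrthonormalBasisOf (Sum.elim (scalingLp A)
      fun i : Σ k : ℕ, WaveletIndex A k => waveletLp A q c i.1 i.2) ⊤ := by
  have hcross : ∀ (i : Fin N) (i' : Σ k : ℕ, WaveletIndex A k),
      inner ℂ (scalingLp A i) (waveletLp A q c i'.1 i'.2) = 0 := fun i i' =>
    Submodule.inner_right_of_mem_orthogonal
      (levelSpace_mono (by omega : 1 ≤ i'.1 + 1) (scalingLp_mem_levelSpace i))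
      (h.waveletLp_mem_orthogonal h01 hc i'.1 i'.2)
  refine ⟨⟨?_, ?_⟩, ?_⟩
  · rintro (i | i)
    · exact h.orthonormal_scalingLp.1 i
    · exact (h.orthonormal_sigma_waveletLp h01 hc).1 i
  · rintro (i | i) (i' | i') hne
    · exact h.orthonormal_scalingLp.2 fun he => hne (by rw [he])
    · exact hcross i i'
    · exact inner_eq_zero_symm.1 (hcross i' i)
    · exact (h.orthonormal_sigma_waveletLp h01 hc).2 fun he => hne (by rw [he])
  · rw [Submodule.topologicalClosure_eq_top_iff, Set.Sum.elim_range, Submodule.span_union,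
      h.span_scalingLp, sup_comm]
    exact h.orthogonal_sup_eq_bot h01 hdiag hc

end IsSelfSimilar
end CKWavelet

theorem theorem3p2 {N : ℕ} (A : Matrix (Fin N) (Fin N) ℕ)
    (h01 : ∀ i j, A i j = 0 ∨ A i j = 1)
    (hdiag : ∀ i, A i i = 1)
    (hirr : ∃ n : ℕ, ∀ i j, 0 < (A ^ n) i j)
    (c : (r : Fin N) → Fin (CKWavelet.outDegree A r - 1) → Fin N → ℂ)
    (hc : CKWavelet.IsMotherFamily A c) :
    ∃ (hψ : ∀ (k : ℕ) (i : CKWavelet.WaveletIndex A k),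
          MemLp (CKWavelet.wavelet A c k i) 2 (CKWavelet.mu A))
      (hχ : ∀ i : Fin N, MemLp (CKWavelet.scaling A i) 2 (CKWavelet.mu A)),
      -- the functions `S_a f^{ℓ,r}` with `a` of length `k` form a basis of `𝔖_{k+2} ⊖ 𝔖_{k+1}`
      (∀ k : ℕ, CKWavelet.IsOrthonormalBasisOf
        (fun i : CKWavelet.WaveletIndex A k => (hψ k i).toLp (CKWavelet.wavelet A c k i))
        (CKWavelet.levelDiff A (k + 2) (k + 1))) ∧
      -- for the remaining pairs `(a, r)` the function `S_a f^{ℓ,r}` is zero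
      (∀ (a : List (Fin N)) (r : Fin N) (l : Fin (CKWavelet.outDegree A r - 1)),
        CKWavelet.Admissible A a → ¬ CKWavelet.Admissible A (a ++ [r]) →
        CKWavelet.SWord A a (CKWavelet.mother A c r l) = 0) ∧
      -- all wavelets together form a basis of the orthogonal complement of `𝔖_1`
      CKWavelet.IsOrthonormalBasisOf
        (fun i : (Σ k : ℕ, CKWavelet.WaveletIndex A k) =>
          (hψ i.1 i.2).toLp (CKWavelet.wavelet A c i.1 i.2))
        (CKWavelet.levelSpace A 1)ᗮ ∧
      -- and, with the normalized characteristic functions of the `R_i`, a basis of `L²(Λ_A, μ_A)`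
      CKWavelet.IsOrthonormalBasisOf
        (Sum.elim (fun i : Fin N => (hχ i).toLp (CKWavelet.scaling A i))
          (fun i : (Σ k : ℕ, CKWavelet.WaveletIndex A k) =>
            (hψ i.1 i.2).toLp (CKWavelet.wavelet A c i.1 i.2)))
        (⊤ : Submodule ℂ (Lp ℂ 2 (CKWavelet.mu A))) := by
  have h := CKWavelet.isSelfSimilar h01 hdiag hirr
  have := h.isFiniteMeasure
  -- Almost everywhere equality with the explicit `L²` elements gives square integrability, and then
  -- identifies the classes.
  have hψ : ∀ (k : ℕ) (i : CKWavelet.WaveletIndex A k),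
      MemLp (CKWavelet.wavelet A c k i) 2 (CKWavelet.mu A) := fun k i =>
    (Lp.memLp _).ae_eq (h.waveletLp_coeFn k i)
  have hχ : ∀ i : Fin N, MemLp (CKWavelet.scaling A i) 2 (CKWavelet.mu A) := fun i =>
    (Lp.memLp _).ae_eq (CKWavelet.scalingLp_coeFn i)
  have hψ' : ∀ k i, (hψ k i).toLp (CKWavelet.wavelet A c k i) =
      CKWavelet.waveletLp A (CKWavelet.contraction A) c k i := fun k i =>
    Lp.ext ((hψ k i).coeFn_toLp.trans (h.waveletLp_coeFn k i).symm)
  have hχ' : ∀ i, (hχ i).toLp (CKWavelet.scaling A i) = CKWavelet.scalingLp A i := fun i =>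
    Lp.ext ((hχ i).coeFn_toLp.trans (CKWavelet.scalingLp_coeFn i).symm)
  refine ⟨hψ, hχ, fun k => ?_, fun a r l _ har => CKWavelet.SWord_mother_eq_zero c a r l har, ?_, ?_⟩
  · simp only [hψ']
    exact h.isOrthonormalBasisOf_levelDiff h01 hdiag hc k
  · simp only [hψ']
    exact h.isOrthonormalBasisOf_orthogonal h01 hdiag hc
  · simp only [hψ', hχ']
    exact h.isOrthonormalBasisOf_top h01 hdiag hc
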